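/- **Model.** Let $G=(V,E)$ be a finite simple graph whose nodes carry pairwise distinct identifiers (from an arbitrary identifier space with at least $|V|$ elements, e.g. $\{1,\dots,|V|\}$), and let every node draw an independent random value from a common probability space. The $k$-round view of a node $v$ consists of the identity of $v$ together with the identifiers and random values of all nodes at distance at most $k$ from $v$ and all edges among them, except edges joining two nodes at distance exactly $k$ from $v$. A (possibly randomized) $k$-round distributed algorithm assigns to each edge $\{u,v\}\in E$ a value $y_{\{u,v\}}\in\mathbb R$ that is a function of the $k$-round views of $u$ and $v$ only; a deterministic algorithm is one that ignores the random values. It is an algorithm for fractional maximum matching on $G$ if, for every assignment of identifiers, almost surely $y_e\ge 0$ for all $e\in E$ and $\sum_{e\ni v}y_e\le 1$ for all $v\in V$; it is an algorithm for maximum matching on $G$ if, for every assignment of identifiers, almost surely $y$ is the 0/1 indicator vector of a matching of $G$. It has approximation ratio at most $\alpha$ on $G$ if $\mathrm{OPT}\le\alpha\cdot\mathbb E\big[\sum_{e\in E}y_e\big]$ for every assignment of identifiers, where $\mathrm{OPT}$ is the largest value of $\sum_{e\in E} y_e$ over all feasible solutions of the respective problem. **Theorem.** For every $\varepsilon>0$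 there is a constant $c>0$, depending only on $\varepsilon$, such that for every integer $k\ge 1$ there are graphs $G$, with arbitrarily large number of nodes $n$ and arbitrarily large maximum degree $\Delta$, on which every (possibly randomized) $k$-round distributed algorithm for maximum matching, and every such algorithm for fractional maximum matching, has approximation ratio at least $$c\cdot n^{\frac{1/4-\varepsilon}{k^2}}\qquad\text{and at least}\qquad c\cdot\Delta^{\frac{1-\varepsilon}{k+1}}.$$ -/

import Mathlib

open MeasureTheory

/-- What a node knows after some number of rounds: its own identifier, the nodes it has heard of
(each given by its identifier together with the random value drawn at that node), and the edges it
has heard of (as unordered pairs of identifiers). As identifiers are unique, this is the labelled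
topology around the node. -/
structure View (ID R : Type) where
  root : ID
  nodes : Set (ID × R)
  edges : Set (Sym2 ID)

/-- The view of `v` after `k` rounds: the graph induced by the nodes at distance at most `k` from
`v`, without the edges between two nodes at distance exactly `k`, with the identifiers `id` and the
random values `ω` of these nodes. (`edist` is the graph distance, `⊤` between components.) -/
def localView {V ID R : Type} (G : SimpleGraph V) (k : ℕ) (id : V → ID) (ω : V → R) (v : V) :
    View ID R where
  root := id v
  nodes := {p | ∃ u, G.edist v u ≤ k ∧ p = (id u, ω u)}
  edges := {e | ∃ u w, G.Adj u w ∧ G.edist v u ≤ k ∧ G.edist v w ≤ k ∧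
    ¬ (G.edist v u = k ∧ G.edist v w = k) ∧ e = s(id u, id w)}

/-- The edge values computed by a `k`-round algorithm `out`: the value of an edge is a function
of the views of its two endpoints. -/
def localOutput {V ID R : Type} (G : SimpleGraph V) (k : ℕ) (out : Sym2 (View ID R) → ℝ)
    (id : V → ID) (ω : V → R) : G.edgeSet → ℝ :=
  fun e => out (e.1.map (localView G k id ω))

open Classical in
/-- The objective value (total edge value) of an assignment of values to the edges. -/
noncomputable def edgeValue {V : Type} [Fintype V] (G : SimpleGraph V) (y : G.edgeSet → ℝ) : ℝ :=
  ∑ e, y e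

open Classical in
/-- The feasible fractional matchings of `G`: non-negative edge values whose sum over the edges
incident to any node is at most `1`. -/
def fractionalMatchings {V : Type} [Fintype V] (G : SimpleGraph V) : Set (G.edgeSet → ℝ) :=
  {y | (∀ e, 0 ≤ y e) ∧ ∀ v : V, ∑ e : G.edgeSet with v ∈ e.1, y e ≤ 1}

open Classical in
/-- The matchings of `G`, as 0/1 edge values. -/
def integralMatchings {V : Type} (G : SimpleGraph V) : Set (G.edgeSet → ℝ) :=
  {y | ∃ M : G.Subgraph, M.IsMatching ∧
    y = fun e : G.edgeSet => if e.1 ∈ M.edgeSet then 1 else 0}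

/-- The optimal (largest) objective value over a set `F` of feasible solutions. -/
noncomputable def optValue {V : Type} [Fintype V] (G : SimpleGraph V) (F : Set (G.edgeSet → ℝ)) :
    ℝ :=
  sSup (edgeValue G '' F)

/-- The randomized `k`-round algorithm `out`, where every node independently draws a random value
according to `μ`, solves the problem with feasible set `F` on `G`: for every assignment of unique
identifiers its output is a random vector that lies in `F` almost surely. -/
def IsLocalAlgorithm {V ID R : Type} [Fintype V] [MeasurableSpace R] (G : SimpleGraph V)
    (F : Set (G.edgeSet → ℝ)) (k : ℕ) (μ : Measure R) (out : Sym2 (View ID R) → ℝ) : Prop :=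
  ∀ id : V ↪ ID,
    (∀ e, AEMeasurable (fun ω : V → R => localOutput G k out id ω e) (Measure.pi fun _ => μ)) ∧
    ∀ᵐ ω ∂(Measure.pi fun _ : V => μ), localOutput G k out id ω ∈ F

/-- The algorithm has approximation ratio (at most) `α` on `G`: for every assignment of unique
identifiers, the optimum is at most `α` times the expected objective value of the output. -/
def HasApproxRatio {V ID R : Type} [Fintype V] [MeasurableSpace R] (G : SimpleGraph V)
    (F : Set (G.edgeSet → ℝ)) (k : ℕ) (μ : Measure R) (out : Sym2 (View ID R) → ℝ) (α : ℝ) :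
    Prop :=
  ∀ id : V ↪ ID,
    optValue G F ≤ α * ∫ ω, edgeValue G (localOutput G k out id ω) ∂(Measure.pi fun _ : V => μ)

/-!
Why the bound holds. Fix the number of rounds, write it as `k + 1`, and let `δ` be a large degree
parameter. The graph is partitioned into clusters that form a tree (`IsCluster`). Every vertex has
one neighbour in its own cluster, so that these edges form a perfect matching and the optimum is at
least half the number of vertices. All other edges join a cluster to its parent in the tree, and an
arc labelled `l` stands for `δ ^ (l - 1)` neighbours of each vertex; towards the parent a label is
larger by one than in the opposite direction. By double counting, a child is smaller than its
parent by the factor `δ`, so nearly all vertices belong to the root cluster, and a good algorithm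
has to choose most of the matching edges inside the root cluster.

It cannot recognise them. The trees of non-backtracking walks entered through an edge have
isomorphism types (`branchType`) that are nested multisets. As the types of all sub-branches
occur at every vertex with multiplicities depending only on the label, a type is the sum over all
labels minus the one sub-branch through which the branch is entered; by induction on the depth,
branches at the edges inside the root cluster and at the edges between the root cluster and its
child of label `1` have the same type (`IsClusterGraph.branchType_eq`). If the girth is at least
`2 * (k + 1) + 2`, the view of an edge is a tree, and equal types yield a permutation of the
vertices carrying the view of one edge to that of the other (`exists_perm_localView`). Averaging
over all assignments of identifiers turns the expected output into a fractional matching that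
takes the same value on these edges (`exists_symmetric_fractionalMatching`). Since a vertex of the
child has `δ` neighbours in the root cluster, the value is at most `1 / δ`; hence the total is at
most a fraction of order `1 / δ` of the optimum (`IsClusterGraph.edgeValue_le`).

It remains to realise the prescribed degrees with large girth and few vertices
(`exists_graph_of_degrees`). Starting from an arbitrary bipartite multigraph with these degrees,
edges on shortest cycles are exchanged with far edges of the same kind
(`exists_perm_not_onShortCycle`). This works as soon as each cluster is larger than twice a
ball of radius `2 * k + 1`, which gives at most `A * δ ^ (4 * (k + 1) ^ 2)` vertices and maximum
degree at most `A * δ ^ (k + 2)`, with `A` depending only on `k`. The factor `A`, and the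
`k`-dependent factor in the bound `δ / (4 * A)` on the ratio, are absorbed by `ε` for large `δ`.
-/

/-! ### Branches of a graph and their isomorphism types -/

/-- Isomorphism types of rooted trees truncated at a given depth: a truncated tree is described by
the multiset of the types of the subtrees hanging at the children of its root. -/
def BranchType : ℕ → Type
  | 0 => Unit
  | r + 1 => Multiset (BranchType r)

open Classical in
/-- The type of the tree of non-backtracking walks of at most `r` further steps that have just
entered `y` from `x`. -/
noncomputable def branchType {V : Type} [Fintype V] (G : SimpleGraph V) :
    (r : ℕ) → V → V → BranchType r
  | 0, _, _ => ()
  | r + 1, x, y => ((G.neighborFinset y).val.erase x).map fun z => branchType G r y z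

/-- The directed edge `(a, b)` is traversed by a non-backtracking walk that starts with the
directed edge `(x, y)` and then makes at most `r` further steps. -/
inductive IsBranchDart {V : Type} (G : SimpleGraph V) : ℕ → V → V → V → V → Prop
  | root (r : ℕ) (x y : V) : IsBranchDart G r x y x y
  | step {r : ℕ} {x y z a b : V} : G.Adj y z → z ≠ x → IsBranchDart G r y z a b →
      IsBranchDart G (r + 1) x y a b

/-- The vertex `z` is reached by a non-backtracking walk that starts with the directed edge
`(x, y)` and then makes at most `r` further steps. -/
def InBranch {V : Type} (G : SimpleGraph V) (r : ℕ) (x y z : V) : Prop :=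
  ∃ a, IsBranchDart G r x y a z

namespace IsBranchDart

variable {V : Type} {G : SimpleGraph V}

theorem mono {r s : ℕ} {x y a b : V} (h : IsBranchDart G r x y a b) (hrs : r ≤ s) :
    IsBranchDart G s x y a b := by
  induction h generalizing s with
  | root => exact .root ..
  | step h1 h2 _ ih =>
    obtain ⟨s, rfl⟩ : ∃ t, s = t + 1 := ⟨s - 1, by omega⟩
    exact .step h1 h2 (ih (by omega))

theorem adj {r : ℕ} {x y a b : V} (h : IsBranchDart G r x y a b) (hxy : G.Adj x y) :
    G.Adj a b := by
  induction h with
  | root => exact hxy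
  | step h1 _ _ ih => exact ih h1

theorem exists_walk {r : ℕ} {x y a b : V} (h : IsBranchDart G r x y a b) (hxy : G.Adj x y) :
    ∃ q : G.Walk y b, q.length ≤ r ∧ (SimpleGraph.Walk.cons hxy q).edges.IsChain (· ≠ ·) := by
  induction h with
  | root => exact ⟨.nil, by simp, by simp⟩
  | @step r x y z a b h1 h2 _ ih =>
    obtain ⟨q, hq, hc⟩ := ih h1
    refine ⟨.cons h1 q, by simpa using hq, ?_⟩
    simp only [SimpleGraph.Walk.edges_cons] at hc ⊢
    refine List.IsChain.cons_cons ?_ hc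
    rw [ne_eq, Sym2.eq_iff]
    rintro (⟨rfl, rfl⟩ | ⟨rfl, _⟩)
    · exact h1.ne rfl
    · exact h2 rfl

/-- The last directed edge of a path that does not return to `x` is a directed edge of the branch
that the path starts in. -/
theorem of_path {x y c z : V} (p : G.Walk y c) (h : G.Adj c z) (hp : (p.concat h).IsPath)
    (hx : x ∉ (p.concat h).support) : IsBranchDart G (p.length + 1) x y c z := by
  induction p generalizing x with
  | @nil y =>
    refine .step h ?_ (.root ..)
    rintro rfl
    simp [SimpleGraph.Walk.concat] at hx
  | @cons y b c h' p ih =>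
    rw [SimpleGraph.Walk.concat_cons] at hp hx
    rw [SimpleGraph.Walk.cons_isPath_iff] at hp
    rw [SimpleGraph.Walk.support_cons, List.mem_cons, not_or] at hx
    refine .step h' ?_ (ih h hp.1 hp.2)
    rintro rfl
    exact hx.2 (SimpleGraph.Walk.start_mem_support _)

end IsBranchDart

/-! ### Branches in graphs of large girth -/

/-- Two non-backtracking walks with the same ends coincide if their lengths sum up to less than
the girth: the edges of the two walks form a forest. -/
theorem SimpleGraph.Walk.eq_of_isChain_edges {V : Type} {G : SimpleGraph V} {u v : V}
    (p q : G.Walk u v) (hp : p.edges.IsChain (· ≠ ·)) (hq : q.edges.IsChain (· ≠ ·))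
    (h : ((p.length + q.length : ℕ) : ℕ∞) < G.egirth) : p = q := by
  classical
  let S : Finset (Sym2 V) := p.edges.toFinset ∪ q.edges.toFinset
  let H : SimpleGraph V := SimpleGraph.fromEdgeSet (S : Set (Sym2 V))
  have hSG : ∀ e ∈ S, e ∈ G.edgeSet := by
    intro e he
    rcases Finset.mem_union.1 he with he | he
    · exact p.edges_subset_edgeSet (List.mem_toFinset.1 he)
    · exact q.edges_subset_edgeSet (List.mem_toFinset.1 he)
  have hH : ∀ e, e ∈ H.edgeSet ↔ e ∈ S := by
    intro e
    simp only [H, SimpleGraph.edgeSet_fromEdgeSet, Set.mem_sdiff, Finset.mem_coe]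
    exact ⟨fun h => h.1, fun h => ⟨h, G.not_isDiag_of_mem_edgeSet (hSG e h)⟩⟩
  have hpH : ∀ e ∈ p.edges, e ∈ H.edgeSet := fun e he =>
    (hH e).2 (Finset.mem_union_left _ (List.mem_toFinset.2 he))
  have hqH : ∀ e ∈ q.edges, e ∈ H.edgeSet := fun e he =>
    (hH e).2 (Finset.mem_union_right _ (List.mem_toFinset.2 he))
  have hac : H.IsAcyclic := by
    intro w c hc
    have hcG : ∀ e ∈ c.edges, e ∈ G.edgeSet := fun e he =>
      hSG e ((hH e).1 (c.edges_subset_edgeSet he))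
    have h1 : G.egirth ≤ (c.transfer G hcG).length :=
      SimpleGraph.egirth_le_length (hc.transfer hcG)
    rw [SimpleGraph.Walk.length_transfer] at h1
    have h2 : c.length ≤ p.length + q.length := by
      rw [← SimpleGraph.Walk.length_edges, ← List.toFinset_card_of_nodup hc.edges_nodup]
      calc c.edges.toFinset.card ≤ S.card := Finset.card_le_card fun e he =>
            (hH e).1 (c.edges_subset_edgeSet (List.mem_toFinset.1 he))
        _ ≤ _ := Finset.card_union_le _ _
        _ ≤ _ := by
          rw [← p.length_edges, ← q.length_edges]
          exact Nat.add_le_add (List.toFinset_card_le _) (List.toFinset_card_le _)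
    have h3 : (c.length : ℕ∞) ≤ ((p.length + q.length : ℕ) : ℕ∞) := by exact_mod_cast h2
    exact absurd h (not_lt.2 (h1.trans h3))
  have e1 : (p.transfer H hpH).IsPath := by
    rw [hac.isPath_iff_isChain, SimpleGraph.Walk.edges_transfer]; exact hp
  have e2 : (q.transfer H hqH).IsPath := by
    rw [hac.isPath_iff_isChain, SimpleGraph.Walk.edges_transfer]; exact hq
  have e3 := congrArg Subtype.val
    ((hac.subsingleton_path u v).elim ⟨_, e1⟩ ⟨_, e2⟩)
  apply SimpleGraph.Walk.ext_support
  have e4 := congrArg SimpleGraph.Walk.support e3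
  simpa using e4

section Girth

variable {V : Type} {G : SimpleGraph V} {r : ℕ}

theorem InBranch.eq_of_egirth {y b c z : V} (hb : G.Adj y b) (hc : G.Adj y c)
    (h1 : InBranch G r y b z) (h2 : InBranch G r y c z)
    (hg : ((2 * r + 2 : ℕ) : ℕ∞) < G.egirth) : b = c := by
  obtain ⟨a1, h1⟩ := h1
  obtain ⟨a2, h2⟩ := h2
  obtain ⟨p, hp, hpc⟩ := h1.exists_walk hb
  obtain ⟨q, hq, hqc⟩ := h2.exists_walk hc
  have := SimpleGraph.Walk.eq_of_isChain_edges _ _ hpc hqc (lt_of_le_of_lt (by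
    simp only [SimpleGraph.Walk.length_cons]
    exact_mod_cast (by omega)) hg)
  injection this

theorem not_inBranch_self_of_egirth {y b : V} (hb : G.Adj y b)
    (hg : ((r + 1 : ℕ) : ℕ∞) < G.egirth) : ¬ InBranch G r y b y := by
  rintro ⟨a1, h1⟩
  obtain ⟨p, hp, hpc⟩ := h1.exists_walk hb
  have := SimpleGraph.Walk.eq_of_isChain_edges _ .nil hpc (by simp) (lt_of_le_of_lt (by
    simp only [SimpleGraph.Walk.length_cons, SimpleGraph.Walk.length_nil]
    exact_mod_cast (by omega)) hg)
  cases this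

theorem InBranch.not_symm_of_egirth {u v z : V} (huv : G.Adj u v)
    (h1 : InBranch G r u v z) (hg : ((2 * r + 1 : ℕ) : ℕ∞) < G.egirth) :
    ¬ InBranch G r v u z := by
  rintro ⟨a2, h2⟩
  obtain ⟨a1, h1⟩ := h1
  obtain ⟨p, hp, hpc⟩ := h1.exists_walk huv
  obtain ⟨q, hq, hqc⟩ := h2.exists_walk huv.symm
  have hpc' := hpc
  rw [SimpleGraph.Walk.edges_cons] at hpc'
  have := SimpleGraph.Walk.eq_of_isChain_edges _ _ hpc'.tail hqc (lt_of_le_of_lt (by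
    simp only [SimpleGraph.Walk.length_cons]
    exact_mod_cast (by omega)) hg)
  subst this
  simp [Sym2.eq_swap] at hpc

end Girth

/-! ### Isomorphisms between branches of the same type -/

/-- `R` is (the graph of) an isomorphism between the branch of depth `r` entered through `(x, y)`
and the one entered through `(x', y')`. -/
structure IsBranchIso {V : Type} (G : SimpleGraph V) (r : ℕ) (x y x' y' : V)
    (R : V → V → Prop) : Prop where
  dom : ∀ {a a'}, R a a' → InBranch G r x y a ∧ InBranch G r x' y' a'
  biunique : ∀ {a a' b b'}, R a a' → R b b' → (a = b ↔ a' = b')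
  root : R y y'
  fwd : ∀ {s a b}, s ≤ r → IsBranchDart G s x y a b → (a = x ∧ b = y) ∨
    ∃ a' b', IsBranchDart G s x' y' a' b' ∧ R a a' ∧ R b b'
  bwd : ∀ {s a' b'}, s ≤ r → IsBranchDart G s x' y' a' b' → (a' = x' ∧ b' = y') ∨
    ∃ a b, IsBranchDart G s x y a b ∧ R a a' ∧ R b b'

/-- Multisets with the same image under two maps are matched by a bijection. -/
theorem Finset.exists_bij_of_map_eq {α β γ : Type} (s : Finset α) (t : Finset β) (f : α → γ)
    (g : β → γ) (h : s.val.map f = t.val.map g) :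
    ∃ P : α → β → Prop, (∀ {a b}, P a b → a ∈ s ∧ b ∈ t ∧ f a = g b) ∧
      (∀ {a b a' b'}, P a b → P a' b' → (a = a' ↔ b = b')) ∧
      (∀ a ∈ s, ∃ b, P a b) ∧ (∀ b ∈ t, ∃ a, P a b) := by
  classical
  induction s using Finset.induction generalizing t with
  | empty =>
    have : t = ∅ := by
      rw [← Finset.val_eq_zero, ← Multiset.map_eq_zero (f := g), ← h]; rfl
    subst this
    exact ⟨fun _ _ => False, by simp, by simp, by simp, by simp⟩
  | insert a s has ih =>
    rw [Finset.insert_val_of_notMem has, Multiset.map_cons] at h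
    have hmem : f a ∈ t.val.map g := h ▸ Multiset.mem_cons_self _ _
    obtain ⟨b, hb, hgb⟩ := Multiset.mem_map.1 hmem
    have hb' : b ∈ t := hb
    obtain ⟨P, h1, h2, h3, h4⟩ := ih (t.erase b) (by
      rw [Finset.erase_val, Multiset.map_erase_of_mem g t.val hb, ← h, hgb,
        Multiset.erase_cons_head])
    refine ⟨fun x y => (x = a ∧ y = b) ∨ P x y, ?_, ?_, ?_, ?_⟩
    · rintro x y (⟨rfl, rfl⟩ | hP)
      · exact ⟨Finset.mem_insert_self _ _, hb', hgb.symm⟩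
      · obtain ⟨i, j, k⟩ := h1 hP
        exact ⟨Finset.mem_insert_of_mem i, Finset.mem_of_mem_erase j, k⟩
    · rintro x y x' y' (⟨rfl, rfl⟩ | hP) (⟨rfl, rfl⟩ | hP')
      · simp
      · obtain ⟨i, j, k⟩ := h1 hP'
        constructor
        · rintro rfl; exact absurd i has
        · rintro rfl; exact absurd j (Finset.notMem_erase _ _)
      · obtain ⟨i, j, k⟩ := h1 hP
        constructor
        · rintro rfl; exact absurd i has
        · rintro rfl; exact absurd j (Finset.notMem_erase _ _)
      · exact h2 hP hP'
    · intro x hx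
      rcases Finset.mem_insert.1 hx with rfl | hx
      · exact ⟨b, .inl ⟨rfl, rfl⟩⟩
      · obtain ⟨y, hy⟩ := h3 x hx
        exact ⟨y, .inr hy⟩
    · intro y hy
      by_cases hyb : y = b
      · exact ⟨a, .inl ⟨rfl, hyb⟩⟩
      · obtain ⟨x, hx⟩ := h4 y (Finset.mem_erase.2 ⟨hyb, hy⟩)
        exact ⟨x, .inr hx⟩

/-- Branches of the same type are isomorphic as long as the girth rules out that two of their
sub-branches meet. -/
theorem exists_isBranchIso {V : Type} [Fintype V] {G : SimpleGraph V} {r : ℕ} {x y x' y' : V}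
    (hxy : G.Adj x y) (hxy' : G.Adj x' y') (hg : ((2 * r : ℕ) : ℕ∞) < G.egirth)
    (h : branchType G r x y = branchType G r x' y') : ∃ R, IsBranchIso G r x y x' y' R := by
  classical
  induction r generalizing x y x' y' with
  | zero =>
    refine ⟨fun a a' => a = y ∧ a' = y', ?_, ?_, ⟨rfl, rfl⟩, ?_, ?_⟩
    · rintro a a' ⟨rfl, rfl⟩
      exact ⟨⟨_, .root ..⟩, ⟨_, .root ..⟩⟩
    · rintro a a' b b' ⟨rfl, rfl⟩ ⟨rfl, rfl⟩; simp
    · rintro s a b hs h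
      obtain rfl : s = 0 := by omega
      cases h
      exact .inl ⟨rfl, rfl⟩
    · rintro s a b hs h
      obtain rfl : s = 0 := by omega
      cases h
      exact .inl ⟨rfl, rfl⟩
  | succ r ih =>
    have hg0 : ((2 * r : ℕ) : ℕ∞) < G.egirth := lt_of_le_of_lt (by exact_mod_cast (by omega)) hg
    have hg2 : ((2 * r + 2 : ℕ) : ℕ∞) < G.egirth := hg
    have hg1 : ((r + 1 : ℕ) : ℕ∞) < G.egirth := lt_of_le_of_lt (by exact_mod_cast (by omega)) hg
    obtain ⟨P, hP1, hP2, hP3, hP4⟩ := Finset.exists_bij_of_map_eq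
      ((G.neighborFinset y).erase x) ((G.neighborFinset y').erase x')
      (branchType G r y) (branchType G r y') h
    have hPa : ∀ {b b'}, P b b' → G.Adj y b ∧ b ≠ x ∧ G.Adj y' b' ∧ b' ≠ x' := by
      intro b b' hb
      have := hP1 hb
      simp only [Finset.mem_erase, SimpleGraph.mem_neighborFinset] at this
      tauto
    have hex : ∀ b b', ∃ R, P b b' → IsBranchIso G r y b y' b' R := by
      intro b b'
      by_cases hb : P b b'
      · obtain ⟨R, hR⟩ := ih (hPa hb).1 (hPa hb).2.2.1 hg0 (hP1 hb).2.2
        exact ⟨R, fun _ => hR⟩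
      · exact ⟨fun _ _ => False, fun h => absurd h hb⟩
    choose R hR using hex
    refine ⟨fun a a' => (a = y ∧ a' = y') ∨ ∃ b b', P b b' ∧ R b b' a a', ?_, ?_,
      .inl ⟨rfl, rfl⟩, ?_, ?_⟩
    · rintro a a' (⟨rfl, rfl⟩ | ⟨b, b', hb, ha⟩)
      · exact ⟨⟨_, .root ..⟩, ⟨_, .root ..⟩⟩
      · obtain ⟨⟨c, hc⟩, ⟨c', hc'⟩⟩ := (hR _ _ hb).dom ha
        obtain ⟨i1, i2, i3, i4⟩ := hPa hb
        exact ⟨⟨c, .step i1 i2 hc⟩, ⟨c', .step i3 i4 hc'⟩⟩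
    · rintro a a' c c' (⟨rfl, rfl⟩ | ⟨b, b', hb, ha⟩) (⟨rfl, rfl⟩ | ⟨d, d', hd, hc⟩)
      · simp
      · obtain ⟨j, j'⟩ := (hR _ _ hd).dom hc
        obtain ⟨i1, i2, i3, i4⟩ := hPa hd
        constructor
        · rintro rfl; exact absurd j (not_inBranch_self_of_egirth i1 hg1)
        · rintro rfl; exact absurd j' (not_inBranch_self_of_egirth i3 hg1)
      · obtain ⟨j, j'⟩ := (hR _ _ hb).dom ha
        obtain ⟨i1, i2, i3, i4⟩ := hPa hb
        constructor
        · rintro rfl; exact absurd j (not_inBranch_self_of_egirth i1 hg1)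
        · rintro rfl; exact absurd j' (not_inBranch_self_of_egirth i3 hg1)
      · obtain ⟨j, j'⟩ := (hR _ _ hb).dom ha
        obtain ⟨l, l'⟩ := (hR _ _ hd).dom hc
        obtain ⟨i1, i2, i3, i4⟩ := hPa hb
        obtain ⟨k1, k2, k3, k4⟩ := hPa hd
        constructor
        · rintro rfl
          obtain rfl := j.eq_of_egirth i1 k1 l hg2
          obtain rfl := (hP2 hb hd).1 rfl
          exact ((hR _ _ hb).biunique ha hc).1 rfl
        · rintro rfl
          obtain rfl := j'.eq_of_egirth i3 k3 l' hg2
          obtain rfl := (hP2 hb hd).2 rfl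
          exact ((hR _ _ hb).biunique ha hc).2 rfl
    · intro s a c hs h
      cases h with
      | root => exact .inl ⟨rfl, rfl⟩
      | @step s _ _ b _ _ h1 h2 h3 =>
        right
        obtain ⟨b', hb⟩ := hP3 b (by simp [h1, h2])
        obtain ⟨i1, i2, i3, i4⟩ := hPa hb
        rcases (hR _ _ hb).fwd (by omega) h3 with ⟨rfl, rfl⟩ | ⟨a', c', k1, k2, k3⟩
        · exact ⟨y', b', .step i3 i4 (.root ..), .inl ⟨rfl, rfl⟩,
            .inr ⟨_, _, hb, (hR _ _ hb).root⟩⟩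
        · exact ⟨a', c', .step i3 i4 k1, .inr ⟨_, _, hb, k2⟩, .inr ⟨_, _, hb, k3⟩⟩
    · intro s a c hs h
      cases h with
      | root => exact .inl ⟨rfl, rfl⟩
      | @step s _ _ b' _ _ h1 h2 h3 =>
        right
        obtain ⟨b, hb⟩ := hP4 b' (by simp [h1, h2])
        obtain ⟨i1, i2, i3, i4⟩ := hPa hb
        rcases (hR _ _ hb).bwd (by omega) h3 with ⟨rfl, rfl⟩ | ⟨a', c', k1, k2, k3⟩
        · exact ⟨y, b, .step i1 i2 (.root ..), .inl ⟨rfl, rfl⟩,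
            .inr ⟨_, _, hb, (hR _ _ hb).root⟩⟩
        · exact ⟨a', c', .step i1 i2 k1, .inr ⟨_, _, hb, k2⟩, .inr ⟨_, _, hb, k3⟩⟩

theorem exists_perm_of_biunique {V : Type} [Fintype V] (R : V → V → Prop)
    (hR : ∀ {a a' b b'}, R a a' → R b b' → (a = b ↔ a' = b')) :
    ∃ φ : Equiv.Perm V, ∀ a a', R a a' → φ a = a' := by
  classical
  let f : V → V := fun a => if h : ∃ a', R a a' then h.choose else a
  have hf : ∀ a a', R a a' → f a = a' := by
    intro a a' h
    have h' : ∃ a', R a a' := ⟨a', h⟩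
    simp only [f, dif_pos h']
    exact (hR h'.choose_spec h).1 rfl
  obtain ⟨g, hg⟩ := Set.MapsTo.exists_equiv_extend_of_card_eq (α := V)
    (t := (Finset.univ : Finset V))
    rfl (s := {a | ∃ a', R a a'}) (f := f) (by intro a _; simp) (by
      rintro a ⟨a', ha⟩ b ⟨b', hb⟩ hab
      rw [hf _ _ ha, hf _ _ hb] at hab
      exact (hR ha hb).2 hab)
  refine ⟨g.trans (Equiv.subtypeUnivEquiv (by simp)), fun a a' h => ?_⟩
  have := hg a ⟨a', h⟩
  simp only [Equiv.trans_apply, Equiv.subtypeUnivEquiv_apply]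
  rw [this, hf _ _ h]

/-! ### Views in terms of branches -/

/-- The directed edges that are visible from `u` within `k + 1` rounds, split according to whether
they are reached through the neighbour `v` or not. -/
def VisibleDart {V : Type} (G : SimpleGraph V) (k : ℕ) (u v a b : V) : Prop :=
  IsBranchDart G (k + 1) v u a b ∨ IsBranchDart G k u v a b

theorem IsBranchDart.visibleDart {V : Type} {G : SimpleGraph V} {k : ℕ} {u v b c z : V}
    (hb : G.Adj u b) (h : IsBranchDart G k u b c z) : VisibleDart G k u v c z := by
  by_cases hbv : b = v
  · subst hbv; exact .inr h
  · exact .inl (.step hb hbv h)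

theorem SimpleGraph.edist_le_coe_iff {V : Type} {G : SimpleGraph V} {u v : V} {k : ℕ} :
    G.edist u v ≤ k ↔ ∃ p : G.Walk u v, p.length ≤ k := by
  constructor
  · intro h
    obtain ⟨p, hp⟩ := G.exists_walk_of_edist_ne_top (ne_top_of_le_ne_top (by simp) h)
    rw [← hp] at h
    exact ⟨p, by exact_mod_cast h⟩
  · rintro ⟨p, hp⟩
    exact (SimpleGraph.edist_le p).trans (by exact_mod_cast hp)

theorem VisibleDart.edist_le {V : Type} {G : SimpleGraph V} {k : ℕ} {u v a b : V}
    (huv : G.Adj u v) (h : VisibleDart G k u v a b) :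
    G.edist u b ≤ (k + 1 : ℕ) ∧ (G.edist u a ≤ k ∨ (b = u ∧ a = v)) := by
  have key : ∀ {c : V}, G.Adj u c → IsBranchDart G k u c a b →
      G.edist u b ≤ (k + 1 : ℕ) ∧ G.edist u a ≤ k := by
    intro c hc h
    obtain ⟨p, hp, -⟩ := h.exists_walk hc
    refine ⟨SimpleGraph.edist_le_coe_iff.2 ⟨.cons hc p, by simpa using hp⟩, ?_⟩
    have gen : ∀ {r x y a b}, IsBranchDart G r x y a b → G.Adj x y →
        ∃ p : G.Walk x a, p.length ≤ r := by
      intro r x y a b h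
      induction h with
      | root => exact fun _ => ⟨.nil, by simp⟩
      | step h1 _ _ ih =>
        intro hxy
        obtain ⟨p, hp⟩ := ih h1
        exact ⟨.cons hxy p, by simpa using hp⟩
    exact SimpleGraph.edist_le_coe_iff.2 (gen h hc)
  rcases h with h | h
  · cases h with
    | root => exact ⟨by simp, .inr ⟨rfl, rfl⟩⟩
    | step h1 _ h3 => exact ⟨(key h1 h3).1, .inl (key h1 h3).2⟩
  · exact ⟨(key huv h).1, .inl (key huv h).2⟩

/-- Every edge visible from `u` is a visible directed edge in one of its two directions, namely in
the direction leading away from `u`. -/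
theorem visibleDart_of_edist {V : Type} {G : SimpleGraph V} {k : ℕ} {u v c z : V}
    (h : G.Adj c z) (hc : G.edist u c ≤ k) (hcz : G.edist u c ≤ G.edist u z) :
    VisibleDart G k u v c z := by
  classical
  have htop : G.edist u c ≠ ⊤ := ne_top_of_le_ne_top (by simp) hc
  obtain ⟨p, hp⟩ := G.exists_walk_of_edist_ne_top htop
  have hpk : p.length ≤ k := by rw [← hp] at hc; exact_mod_cast hc
  have hpath : p.IsPath := by
    apply SimpleGraph.Walk.isPath_of_length_eq_dist
    rw [SimpleGraph.dist, ← hp]; simp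
  have hz : z ∉ p.support := by
    intro hz
    have h1 := SimpleGraph.edist_le (p.takeUntil z hz)
    have h2 : (p.takeUntil z hz).length < p.length :=
      SimpleGraph.Walk.length_takeUntil_lt_length hz h.ne'
    have h3 : (p.length : ℕ∞) ≤ (p.takeUntil z hz).length := hp ▸ hcz.trans h1
    have h4 : p.length ≤ (p.takeUntil z hz).length := by exact_mod_cast h3
    omega
  have hcon : (p.concat h).IsPath := by
    rw [SimpleGraph.Walk.concat_isPath_iff]; exact ⟨hpath, hz⟩
  cases p with
  | nil => exact (IsBranchDart.root k u z).visibleDart h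
  | @cons _ b _ hb p =>
    rw [SimpleGraph.Walk.concat_cons, SimpleGraph.Walk.cons_isPath_iff] at hcon
    refine ((IsBranchDart.of_path p h hcon.1 hcon.2).mono ?_).visibleDart hb
    simpa using hpk

/-- The view of `u` consists of the visible directed edges, with their heads. -/
theorem localView_eq {V ID R : Type} {G : SimpleGraph V} {k : ℕ} {u v : V} (huv : G.Adj u v)
    (id : V → ID) (ω : V → R) :
    localView G (k + 1) id ω u =
      { root := id u
        nodes := {p | ∃ a b, VisibleDart G k u v a b ∧ p = (id b, ω b)}
        edges := {e | ∃ a b, VisibleDart G k u v a b ∧ e = s(id a, id b)} } := by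
  unfold localView
  congr 1
  · ext p
    constructor
    · rintro ⟨z, hz, rfl⟩
      by_cases hzu : z = u
      · subst hzu
        exact ⟨v, z, .inl (.root ..), rfl⟩
      · -- the neighbour of `z` on a shortest walk to `u` supplies the edge entering `z`
        obtain ⟨q, hq⟩ := G.exists_walk_of_edist_ne_top (ne_top_of_le_ne_top (by simp) hz)
        obtain ⟨c, p, h, rfl⟩ : ∃ (c : V) (p : G.Walk u c) (h : G.Adj c z), q = p.concat h := by
          cases q with
          | nil => exact absurd rfl hzu
          | cons h q =>
            obtain ⟨c, p, h', e⟩ := SimpleGraph.Walk.exists_cons_eq_concat h q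
            exact ⟨c, p, h', e⟩
        rw [SimpleGraph.Walk.length_concat] at hq
        have h1 := SimpleGraph.edist_le p
        have h2 : p.length ≤ k := by
          rw [← hq] at hz
          have : p.length + 1 ≤ k + 1 := by exact_mod_cast hz
          omega
        refine ⟨c, z, visibleDart_of_edist h (h1.trans (by exact_mod_cast h2)) ?_, rfl⟩
        rw [← hq]
        exact h1.trans (by exact_mod_cast Nat.le_succ _)
    · rintro ⟨a, b, h, rfl⟩
      exact ⟨b, (h.edist_le huv).1, rfl⟩
  · ext e
    constructor
    · rintro ⟨c, z, h, hc, hz, hne, rfl⟩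
      have low : ∀ {w}, G.edist u w ≤ (k + 1 : ℕ) → G.edist u w ≠ (k + 1 : ℕ) →
          G.edist u w ≤ k := by
        intro w h1 h2
        have := lt_of_le_of_ne h1 h2
        rw [Nat.cast_add, Nat.cast_one] at this
        exact Order.le_of_lt_add_one this
      rcases le_total (G.edist u c) (G.edist u z) with hle | hle
      · refine ⟨c, z, visibleDart_of_edist h (low hc ?_) hle, rfl⟩
        intro h'
        exact hne ⟨h', le_antisymm hz (h' ▸ hle)⟩
      · refine ⟨z, c, visibleDart_of_edist h.symm (low hz ?_) hle, Sym2.eq_swap⟩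
        intro h'
        exact hne ⟨le_antisymm hc (h' ▸ hle), h'⟩
    · rintro ⟨a, b, h, rfl⟩
      obtain ⟨h1, h2⟩ := h.edist_le huv
      have hadj : G.Adj a b := by
        rcases h with h | h
        · exact h.adj huv.symm
        · exact h.adj huv
      have hlt : ∀ {j : ℕ}, j < k + 1 → ∀ {w}, G.edist u w ≤ j → G.edist u w < (k + 1 : ℕ) :=
        fun hj _ hw => lt_of_le_of_lt hw (by exact_mod_cast hj)
      rcases h2 with h2 | ⟨rfl, rfl⟩
      · have h3 := hlt (Nat.lt_succ_self k) h2
        exact ⟨a, b, hadj, h3.le, h1, fun h => h3.ne h.1, rfl⟩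
      · have h3 : G.edist b b < (k + 1 : ℕ) := hlt (Nat.succ_pos k) (by simp)
        refine ⟨a, b, hadj, SimpleGraph.edist_le_coe_iff.2 ⟨.cons hadj.symm .nil, by simp⟩, h1,
          fun h => h3.ne h.2, rfl⟩

/-- If a permutation carries the visible directed edges of `u` to those of `u'`, it carries the
view of `u` to the view of `u'`. -/
theorem localView_comp_perm {V ID R : Type} {G : SimpleGraph V} {k : ℕ} {u v u' v' : V}
    (huv : G.Adj u v) (huv' : G.Adj u' v') (φ : Equiv.Perm V) (hu : φ u = u')
    (h1 : ∀ a b, VisibleDart G k u v a b → VisibleDart G k u' v' (φ a) (φ b))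
    (h2 : ∀ a' b', VisibleDart G k u' v' a' b' →
      ∃ a b, VisibleDart G k u v a b ∧ φ a = a' ∧ φ b = b') (id : V → ID) (ω : V → R) :
    localView G (k + 1) (id ∘ φ) (ω ∘ φ) u = localView G (k + 1) id ω u' := by
  rw [localView_eq huv, localView_eq huv']
  congr 1
  · simp [hu]
  · ext p
    constructor
    · rintro ⟨a, b, h, rfl⟩
      exact ⟨φ a, φ b, h1 _ _ h, rfl⟩
    · rintro ⟨a', b', h, rfl⟩
      obtain ⟨a, b, hab, rfl, rfl⟩ := h2 _ _ h
      exact ⟨a, b, hab, rfl⟩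
  · ext p
    constructor
    · rintro ⟨a, b, h, rfl⟩
      exact ⟨φ a, φ b, h1 _ _ h, rfl⟩
    · rintro ⟨a', b', h, rfl⟩
      obtain ⟨a, b, hab, rfl, rfl⟩ := h2 _ _ h
      exact ⟨a, b, hab, rfl⟩

/-- Edges whose branches on both sides have the same types have the same views, up to a
permutation of the vertices. -/
theorem exists_perm_localView {V : Type} [Fintype V] {G : SimpleGraph V} {k : ℕ}
    {u v u' v' : V} (huv : G.Adj u v) (huv' : G.Adj u' v')
    (hg : ((2 * (k + 1) + 1 : ℕ) : ℕ∞) < G.egirth)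
    (h1 : branchType G (k + 1) u v = branchType G (k + 1) u' v')
    (h2 : branchType G (k + 1) v u = branchType G (k + 1) v' u') :
    ∃ φ : Equiv.Perm V, ∀ (ID R : Type) (id : V → ID) (ω : V → R),
      localView G (k + 1) (id ∘ φ) (ω ∘ φ) u = localView G (k + 1) id ω u' ∧
      localView G (k + 1) (id ∘ φ) (ω ∘ φ) v = localView G (k + 1) id ω v' := by
  have hg0 : ((2 * (k + 1) : ℕ) : ℕ∞) < G.egirth := lt_of_le_of_lt (by exact_mod_cast (by omega)) hg
  obtain ⟨R₁, hR₁⟩ := exists_isBranchIso huv huv' hg0 h1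
  obtain ⟨R₂, hR₂⟩ := exists_isBranchIso huv.symm huv'.symm hg0 h2
  obtain ⟨φ, hφ⟩ := exists_perm_of_biunique (fun a a' => R₁ a a' ∨ R₂ a a') (by
    rintro a a' b b' (ha | ha) (hb | hb)
    · exact hR₁.biunique ha hb
    · constructor
      · rintro rfl
        exact absurd (hR₂.dom hb).1 ((hR₁.dom ha).1.not_symm_of_egirth huv hg)
      · rintro rfl
        exact absurd (hR₂.dom hb).2 ((hR₁.dom ha).2.not_symm_of_egirth huv' hg)
    · constructor
      · rintro rfl
        exact absurd (hR₂.dom ha).1 ((hR₁.dom hb).1.not_symm_of_egirth huv hg)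
      · rintro rfl
        exact absurd (hR₂.dom ha).2 ((hR₁.dom hb).2.not_symm_of_egirth huv' hg)
    · exact hR₂.biunique ha hb)
  have hv : φ v = v' := hφ _ _ (.inl hR₁.root)
  have hu : φ u = u' := hφ _ _ (.inr hR₂.root)
  -- each branch is carried to its counterpart at every smaller depth
  have f1 : ∀ s ≤ k + 1, ∀ a b, IsBranchDart G s u v a b → IsBranchDart G s u' v' (φ a) (φ b) := by
    intro s hs a b h
    rcases hR₁.fwd hs h with ⟨rfl, rfl⟩ | ⟨a', b', h', ha, hb⟩
    · rw [hu, hv]; exact .root ..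
    · rw [hφ _ _ (.inl ha), hφ _ _ (.inl hb)]; exact h'
  have f2 : ∀ s ≤ k + 1, ∀ a b, IsBranchDart G s v u a b → IsBranchDart G s v' u' (φ a) (φ b) := by
    intro s hs a b h
    rcases hR₂.fwd hs h with ⟨rfl, rfl⟩ | ⟨a', b', h', ha, hb⟩
    · rw [hu, hv]; exact .root ..
    · rw [hφ _ _ (.inr ha), hφ _ _ (.inr hb)]; exact h'
  have b1 : ∀ s ≤ k + 1, ∀ a' b', IsBranchDart G s u' v' a' b' →
      ∃ a b, IsBranchDart G s u v a b ∧ φ a = a' ∧ φ b = b' := by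
    intro s hs a b h
    rcases hR₁.bwd hs h with ⟨rfl, rfl⟩ | ⟨a', b', h', ha, hb⟩
    · exact ⟨u, v, .root .., hu, hv⟩
    · exact ⟨a', b', h', hφ _ _ (.inl ha), hφ _ _ (.inl hb)⟩
  have b2 : ∀ s ≤ k + 1, ∀ a' b', IsBranchDart G s v' u' a' b' →
      ∃ a b, IsBranchDart G s v u a b ∧ φ a = a' ∧ φ b = b' := by
    intro s hs a b h
    rcases hR₂.bwd hs h with ⟨rfl, rfl⟩ | ⟨a', b', h', ha, hb⟩
    · exact ⟨v, u, .root .., hv, hu⟩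
    · exact ⟨a', b', h', hφ _ _ (.inr ha), hφ _ _ (.inr hb)⟩
  refine ⟨φ, fun ID R id ω => ⟨?_, ?_⟩⟩
  · refine localView_comp_perm huv huv' φ hu ?_ ?_ id ω
    · rintro a b (h | h)
      · exact .inl (f2 _ le_rfl _ _ h)
      · exact .inr (f1 _ (Nat.le_succ k) _ _ h)
    · rintro a' b' (h | h)
      · obtain ⟨a, b, h, e⟩ := b2 _ le_rfl _ _ h
        exact ⟨a, b, .inl h, e⟩
      · obtain ⟨a, b, h, e⟩ := b1 _ (Nat.le_succ k) _ _ h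
        exact ⟨a, b, .inr h, e⟩
  · refine localView_comp_perm huv.symm huv'.symm φ hv ?_ ?_ id ω
    · rintro a b (h | h)
      · exact .inl (f1 _ le_rfl _ _ h)
      · exact .inr (f2 _ (Nat.le_succ k) _ _ h)
    · rintro a' b' (h | h)
      · obtain ⟨a, b, h, e⟩ := b1 _ le_rfl _ _ h
        exact ⟨a, b, .inl h, e⟩
      · obtain ⟨a, b, h, e⟩ := b2 _ (Nat.le_succ k) _ _ h
        exact ⟨a, b, .inr h, e⟩

/-! ### Multigraphs without short cycles -/

/-- In the multigraph whose edge `e` joins `p e` and `q e`, there is a walk of length at most `n`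
from `x` to `y` all of whose edges lie in `S`. -/
inductive Conn {E V : Type} (p q : E → V) (S : Set E) : ℕ → V → V → Prop
  | refl (n : ℕ) (x : V) : Conn p q S n x x
  | fwd {n : ℕ} {e : E} {y : V} : e ∈ S → Conn p q S n (q e) y → Conn p q S (n + 1) (p e) y
  | bwd {n : ℕ} {e : E} {y : V} : e ∈ S → Conn p q S n (p e) y → Conn p q S (n + 1) (q e) y

namespace Conn

variable {E V : Type} {p q : E → V} {S T : Set E} {m n : ℕ} {x y z : V}

theorem mono (h : Conn p q S m x y) (hmn : m ≤ n) (hST : S ⊆ T) : Conn p q T n x y := by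
  induction h generalizing n with
  | refl => exact .refl ..
  | fwd he _ ih =>
    obtain ⟨n, rfl⟩ : ∃ t, n = t + 1 := ⟨n - 1, by omega⟩
    exact .fwd (hST he) (ih (by omega))
  | bwd he _ ih =>
    obtain ⟨n, rfl⟩ : ∃ t, n = t + 1 := ⟨n - 1, by omega⟩
    exact .bwd (hST he) (ih (by omega))

theorem trans (h : Conn p q S m x y) (h' : Conn p q S n y z) : Conn p q S (m + n) x z := by
  induction h with
  | refl => exact h'.mono (by omega) le_rfl
  | fwd he _ ih => rw [Nat.add_right_comm]; exact .fwd he (ih h')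
  | bwd he _ ih => rw [Nat.add_right_comm]; exact .bwd he (ih h')

theorem symm (h : Conn p q S n x y) : Conn p q S n y x := by
  induction h with
  | refl => exact .refl ..
  | fwd he _ ih => exact ih.trans (.bwd he (.refl 0 _))
  | bwd he _ ih => exact ih.trans (.fwd he (.refl 0 _))

theorem congr_left {p' : E → V} (h : Conn p q S n x y) (hp : ∀ e ∈ S, p e = p' e) :
    Conn p' q S n x y := by
  induction h with
  | refl => exact .refl ..
  | fwd he _ ih => rw [hp _ he]; exact .fwd he ih
  | bwd he _ ih => exact .bwd he (hp _ he ▸ ih)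

/-- A walk can be shortened so that it uses a given edge at most once. -/
theorem cut (h : Conn p q S n x y) (e : E) :
    Conn p q (S \ {e}) n x y ∨ ∃ a b, a + b + 1 ≤ n ∧
      ((Conn p q (S \ {e}) a x (p e) ∧ Conn p q (S \ {e}) b (q e) y) ∨
        (Conn p q (S \ {e}) a x (q e) ∧ Conn p q (S \ {e}) b (p e) y)) := by
  induction h with
  | refl => exact .inl (.refl ..)
  | @fwd n g y hg _ ih =>
    by_cases hge : g = e
    · subst hge
      rcases ih with ih | ⟨a, b, hab, ⟨h1, h2⟩ | ⟨h1, h2⟩⟩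
      · exact .inr ⟨0, n, by omega, .inl ⟨.refl .., ih⟩⟩
      · exact .inr ⟨0, b, by omega, .inl ⟨.refl .., h2⟩⟩
      · exact .inl (h2.mono (by omega) le_rfl)
    · have hg' : g ∈ S \ {e} := ⟨hg, hge⟩
      rcases ih with ih | ⟨a, b, hab, ⟨h1, h2⟩ | ⟨h1, h2⟩⟩
      · exact .inl (.fwd hg' ih)
      · exact .inr ⟨a + 1, b, by omega, .inl ⟨.fwd hg' h1, h2⟩⟩
      · exact .inr ⟨a + 1, b, by omega, .inr ⟨.fwd hg' h1, h2⟩⟩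
  | @bwd n g y hg _ ih =>
    by_cases hge : g = e
    · subst hge
      rcases ih with ih | ⟨a, b, hab, ⟨h1, h2⟩ | ⟨h1, h2⟩⟩
      · exact .inr ⟨0, n, by omega, .inr ⟨.refl .., ih⟩⟩
      · exact .inl (h2.mono (by omega) le_rfl)
      · exact .inr ⟨0, b, by omega, .inr ⟨.refl .., h2⟩⟩
    · have hg' : g ∈ S \ {e} := ⟨hg, hge⟩
      rcases ih with ih | ⟨a, b, hab, ⟨h1, h2⟩ | ⟨h1, h2⟩⟩
      · exact .inl (.bwd hg' ih)
      · exact .inr ⟨a + 1, b, by omega, .inl ⟨.bwd hg' h1, h2⟩⟩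
      · exact .inr ⟨a + 1, b, by omega, .inr ⟨.bwd hg' h1, h2⟩⟩

open Classical in
theorem card_ball_le [Fintype E] [Fintype V] [DecidableEq V] {Δ : ℕ}
    (hΔ : ∀ v, Finset.card {e | p e = v} + Finset.card {e | q e = v} ≤ Δ) (n : ℕ) (x : V) :
    Finset.card {y | Conn p q Set.univ n x y} ≤ (Δ + 1) ^ n := by
  induction n generalizing x with
  | zero =>
    rw [pow_zero, Finset.card_le_one]
    have : ∀ y, Conn p q Set.univ 0 x y → x = y := fun y h => by cases h; rfl
    intro a ha b hb
    rw [← this a (Finset.mem_filter.1 ha).2, ← this b (Finset.mem_filter.1 hb).2]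
  | succ n ih =>
    let ball : V → Finset V := fun x => {y | Conn p q Set.univ n x y}
    have hsub : ({y | Conn p q Set.univ (n + 1) x y} : Finset V) ⊆
        {x} ∪ ((Finset.univ.filter fun e => p e = x).biUnion (fun e => ball (q e)) ∪
          (Finset.univ.filter fun e => q e = x).biUnion fun e => ball (p e)) := by
      intro y hy
      have hy := (Finset.mem_filter.1 hy).2
      simp only [ball, Finset.mem_union, Finset.mem_singleton, Finset.mem_biUnion,
        Finset.mem_filter, Finset.mem_univ, true_and]
      cases hy with
      | refl => exact .inl rfl
      | @fwd _ e _ _ h => exact .inr (.inl ⟨e, rfl, h⟩)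
      | @bwd _ e _ _ h => exact .inr (.inr ⟨e, rfl, h⟩)
    have hp : ((Finset.univ.filter fun e => p e = x).biUnion fun e => ball (q e)).card ≤
        (Finset.univ.filter fun e => p e = x).card * (Δ + 1) ^ n :=
      Finset.card_biUnion_le_card_mul _ _ _ fun e _ => ih (q e)
    have hq : ((Finset.univ.filter fun e => q e = x).biUnion fun e => ball (p e)).card ≤
        (Finset.univ.filter fun e => q e = x).card * (Δ + 1) ^ n :=
      Finset.card_biUnion_le_card_mul _ _ _ fun e _ => ih (p e)
    have h1 := (Finset.card_le_card hsub).trans ((Finset.card_union_le _ _).trans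
      (Nat.add_le_add_left (Finset.card_union_le _ _) _))
    have h2 : 1 ≤ (Δ + 1) ^ n := Nat.one_le_pow _ _ (Nat.succ_pos _)
    have h3 := Nat.mul_le_mul_right ((Δ + 1) ^ n) (hΔ x)
    rw [Finset.card_singleton] at h1
    rw [pow_succ]
    nlinarith

end Conn

/-- The edge `g` lies on a closed walk that traverses `g` once and at most `n` other edges. -/
def OnShortCycle {E V : Type} (p q : E → V) (n : ℕ) (g : E) : Prop :=
  Conn p q {g}ᶜ n (p g) (q g)

/-- If no edge lies on a cycle of length at most `m + 1` and the edges `e`, `f` are far apart, then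
exchanging their `p`-ends does not put any further edge on a cycle of length at most `m + 2`, and
takes `e` off all such cycles. -/
theorem OnShortCycle.of_swap {E V : Type} [DecidableEq E] {p q : E → V} {m : ℕ} {e f : E}
    (hm : ∀ g, ¬ OnShortCycle p q m g)
    (h1 : ¬ Conn p q Set.univ (m + 1) (p e) (q f)) (h2 : ¬ Conn p q Set.univ (m + 1) (p f) (q e))
    {n : ℕ} (hn : n ≤ m + 1) {g : E} (hg : OnShortCycle (p ∘ Equiv.swap e f) q n g) :
    OnShortCycle p q n g ∧ g ≠ e := by
  have key : ∀ e f : E, ¬ Conn p q Set.univ (m + 1) (p e) (q f) →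
      ¬ Conn p q Set.univ (m + 1) (p f) (q e) →
      ¬ OnShortCycle (p ∘ Equiv.swap e f) q (m + 1) e := by
    intro e f h1 h2 h
    have hpe : (p ∘ Equiv.swap e f) e = p f := by simp
    have hpf : (p ∘ Equiv.swap e f) f = p e := by simp
    have hag : ∀ g ∈ ({e}ᶜ \ {f} : Set E), (p ∘ Equiv.swap e f) g = p g := by
      intro g hg
      simp only [Set.mem_sdiff, Set.mem_compl_iff, Set.mem_singleton_iff] at hg
      simp [Equiv.swap_apply_of_ne_of_ne hg.1 hg.2]
    rw [OnShortCycle, hpe] at h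
    rcases h.cut f with h | ⟨a, b, hab, ⟨ha, hb⟩ | ⟨ha, hb⟩⟩
    · exact h2 ((h.congr_left hag).mono le_rfl (Set.subset_univ _))
    · rw [hpf] at ha
      have h3 := (ha.congr_left hag).mono le_rfl (Set.subset_univ _)
      exact h2 ((h3.trans (.fwd (Set.mem_univ e) (.refl 0 _))).mono (by omega) le_rfl)
    · exact hm f ((ha.congr_left hag).mono (by omega) (fun g hg => hg.2))
  have he := key e f h1 h2
  have hf : ¬ OnShortCycle (p ∘ Equiv.swap e f) q (m + 1) f := by
    rw [Equiv.swap_comm]; exact key f e h2 h1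
  -- a short cycle through `g` that used `e` (or `f`) would be a short cycle through `e` (or `f`)
  have avoid : ∀ d : E, ¬ OnShortCycle (p ∘ Equiv.swap e f) q (m + 1) d → g ≠ d → ∀ {S : Set E},
      S ⊆ {g}ᶜ → Conn (p ∘ Equiv.swap e f) q S n ((p ∘ Equiv.swap e f) g) (q g) →
      Conn (p ∘ Equiv.swap e f) q (S \ {d}) n ((p ∘ Equiv.swap e f) g) (q g) := by
    intro d hd hgd S hS h
    refine (h.cut d).resolve_right ?_
    rintro ⟨a, b, hab, h3⟩
    apply hd
    have hsub : S \ {d} ⊆ {d}ᶜ := fun g hg => hg.2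
    have hgm : g ∈ ({d}ᶜ : Set E) := hgd
    rcases h3 with ⟨ha, hb⟩ | ⟨ha, hb⟩
    · have h4 := (ha.symm.mono le_rfl hsub).trans
        ((Conn.fwd hgm (.refl 0 _)).trans (hb.symm.mono le_rfl hsub))
      exact h4.mono (by omega) le_rfl
    · have h4 := (hb.mono le_rfl hsub).trans
        ((Conn.bwd hgm (.refl 0 _)).trans (ha.mono le_rfl hsub))
      exact h4.mono (by omega) le_rfl
  have hge : g ≠ e := fun h => he (h ▸ hg.mono hn le_rfl)
  have hgf : g ≠ f := fun h => hf (h ▸ hg.mono hn le_rfl)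
  refine ⟨?_, hge⟩
  have h5 := avoid f hf hgf Set.sdiff_subset (avoid e he hge le_rfl hg)
  have h6 := h5.congr_left (p' := p) (by
    intro d hd
    simp only [Set.mem_sdiff, Set.mem_compl_iff, Set.mem_singleton_iff] at hd
    simp [Equiv.swap_apply_of_ne_of_ne hd.1.2 hd.2])
  rw [Function.comp_apply, Equiv.swap_apply_of_ne_of_ne hge hgf] at h6
  exact h6.mono le_rfl (fun d hd => hd.1.1)

open Classical in
/-- If the classes `κ` of edges are large compared to the balls of radius `M`, the `p`-ends of the
edges can be permuted within the classes so that no cycle of length at most `M + 1` remains. Among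
the permutations without cycles of length at most `m + 1`, one minimising the number of edges on
cycles of length `m + 2` has no such edge, as an exchange with a far edge of the same class would
reduce that number. -/
theorem exists_perm_not_onShortCycle {E V C : Type} [Fintype E] [Fintype V] [DecidableEq V]
    [DecidableEq C] (p q : E → V) (κ : E → C) (Δ M : ℕ) (hpq : ∀ e e', p e ≠ q e')
    (hΔ : ∀ v, Finset.card {e | p e = v} + Finset.card {e | q e = v} ≤ Δ)
    (hκ : ∀ (e : E) (T : Finset V), T.card ≤ (Δ + 1) ^ M →
      2 * Finset.card {f | κ f = κ e ∧ p f ∈ T} < Finset.card {f | κ f = κ e} ∧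
      2 * Finset.card {f | κ f = κ e ∧ q f ∈ T} < Finset.card {f | κ f = κ e}) :
    ∃ σ : Equiv.Perm E, (∀ e, κ (σ e) = κ e) ∧ ∀ g, ¬ OnShortCycle (p ∘ σ) q M g := by
  suffices H : ∀ m ≤ M, ∃ σ : Equiv.Perm E, (∀ e, κ (σ e) = κ e) ∧
      ∀ g, ¬ OnShortCycle (p ∘ σ) q m g from H M le_rfl
  intro m
  induction m with
  | zero =>
    refine fun _ => ⟨1, fun _ => rfl, fun g h => ?_⟩
    have : ∀ {a b}, Conn (p ∘ (1 : Equiv.Perm E)) q {g}ᶜ 0 a b → a = b := fun h => by cases h; rfl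
    exact hpq _ _ (this h)
  | succ m ih =>
    intro hmM
    let good : Finset (Equiv.Perm E) :=
      {σ | (∀ e, κ (σ e) = κ e) ∧ ∀ g, ¬ OnShortCycle (p ∘ σ) q m g}
    let bad : Equiv.Perm E → Finset E := fun σ => {g | OnShortCycle (p ∘ σ) q (m + 1) g}
    obtain ⟨σ₀, hσ₀⟩ := ih (by omega)
    obtain ⟨σ, hσ, hmin⟩ := good.exists_min_image (fun σ => (bad σ).card)
      ⟨σ₀, by simpa [good] using hσ₀⟩
    obtain ⟨hσκ, hσm⟩ := (Finset.mem_filter.1 hσ).2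
    refine ⟨σ, hσκ, fun e he => ?_⟩
    have hcard : ∀ (P : E → Prop) [DecidablePred P],
        Finset.card {f | P (σ f)} = Finset.card {f | P f} := by
      intro P _
      refine Finset.card_bij (fun f _ => σ f) ?_ ?_ ?_
      · intro f hf; simpa using hf
      · intro a _ b _ h; exact σ.injective h
      · intro b hb; exact ⟨σ.symm b, by simpa using hb, by simp⟩
    have hball := Conn.card_ball_le (p := p ∘ σ) (q := q) (Δ := Δ) (by
      intro v
      rw [show Finset.card {e | (p ∘ σ) e = v} = Finset.card {e | p e = v} from
        hcard fun e => p e = v]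
      exact hΔ v)
    have hpow : (Δ + 1) ^ (m + 1) ≤ (Δ + 1) ^ M := Nat.pow_le_pow_right (Nat.succ_pos _) hmM
    obtain ⟨f, hfκ, hf1, hf2⟩ : ∃ f, κ f = κ e ∧
        ¬ Conn (p ∘ σ) q Set.univ (m + 1) ((p ∘ σ) e) (q f) ∧
        ¬ Conn (p ∘ σ) q Set.univ (m + 1) ((p ∘ σ) f) (q e) := by
      by_contra! hcon
      let T₁ : Finset V := {y | Conn (p ∘ σ) q Set.univ (m + 1) ((p ∘ σ) e) y}
      let T₂ : Finset V := {y | Conn (p ∘ σ) q Set.univ (m + 1) (q e) y}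
      have hsub : (Finset.univ.filter fun f => κ f = κ e) ⊆
          (Finset.univ.filter fun f => κ f = κ e ∧ q f ∈ T₁) ∪
          (Finset.univ.filter fun f => κ (σ f) = κ e ∧ p (σ f) ∈ T₂) := by
        intro f hf
        have hf := (Finset.mem_filter.1 hf).2
        by_cases h : Conn (p ∘ σ) q Set.univ (m + 1) ((p ∘ σ) e) (q f)
        · exact Finset.mem_union_left _ (by simpa [hf, T₁] using h)
        · exact Finset.mem_union_right _ (by simpa [hσκ, hf, T₂] using (hcon f hf h).symm)
      have h1 := (Finset.card_le_card hsub).trans (Finset.card_union_le _ _)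
      have h2 := (hκ e T₁ ((hball (m + 1) ((p ∘ σ) e)).trans hpow)).2
      have h3 := (hκ e T₂ ((hball (m + 1) (q e)).trans hpow)).1
      have h4 := hcard fun f => κ f = κ e ∧ p f ∈ T₂
      omega
    have hstep : ∀ {g}, OnShortCycle (p ∘ (σ * Equiv.swap e f)) q (m + 1) g →
        OnShortCycle (p ∘ σ) q (m + 1) g ∧ g ≠ e := fun {g} hg =>
      OnShortCycle.of_swap (p := p ∘ σ) hσm hf1 hf2 le_rfl hg
    have hgood : σ * Equiv.swap e f ∈ good := by
      refine Finset.mem_filter.2 ⟨Finset.mem_univ _, fun d => ?_, fun g hg => ?_⟩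
      · rw [Equiv.Perm.mul_apply, hσκ]
        rcases eq_or_ne d e with rfl | h1
        · rw [Equiv.swap_apply_left, hfκ]
        · rcases eq_or_ne d f with rfl | h2
          · rw [Equiv.swap_apply_right, hfκ]
          · rw [Equiv.swap_apply_of_ne_of_ne h1 h2]
      · exact hσm g (OnShortCycle.of_swap (p := p ∘ σ) hσm hf1 hf2 (Nat.le_succ m) hg).1
    have hlt : (bad (σ * Equiv.swap e f)).card < (bad σ).card := by
      apply Finset.card_lt_card
      refine Finset.ssubset_iff_of_subset (fun g hg => ?_) |>.2 ⟨e, by simpa [bad] using he, ?_⟩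
      · simpa [bad] using (hstep ((Finset.mem_filter.1 hg).2)).1
      · intro h
        exact (hstep (Finset.mem_filter.1 h).2).2 rfl
    exact absurd (hmin _ hgood) (not_le.2 hlt)

/-! ### Graphs of large girth with prescribed degrees between clusters -/

theorem Fin.card_divNat_eq {m n : ℕ} (j : Fin m) :
    Finset.card {i : Fin (m * n) | i.divNat = j} = n := by
  have : (Finset.univ.filter fun i : Fin (m * n) => i.divNat = j) =
      (Finset.univ : Finset (Fin n)).map
        ⟨fun l => finProdFinEquiv (j, l), fun a b h => by simpa using h⟩ := by
    ext i
    simp only [Finset.mem_filter, Finset.mem_univ, true_and, Finset.mem_map]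
    constructor
    · rintro rfl
      exact ⟨i.modNat, finProdFinEquiv.apply_symm_apply i⟩
    · rintro ⟨l, rfl⟩
      exact congrArg Prod.fst (finProdFinEquiv.symm_apply_apply (j, l))
  rw [this, Finset.card_map, Finset.card_univ, Fintype.card_fin]

/-- In a graph formed by the edges of a multigraph, a cycle makes each of its edges lie on a short
cycle of the multigraph. -/
theorem egirth_of_not_onShortCycle {E V : Type} {p q : E → V} {G : SimpleGraph V} {M : ℕ}
    (hG : ∀ {a b}, G.Adj a b ↔ ∃ e, (p e = a ∧ q e = b) ∨ (p e = b ∧ q e = a))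
    (hM : ∀ g, ¬ OnShortCycle p q M g) (u : V) (c : G.Walk u u) (hc : c.IsCycle) :
    M + 1 < c.length := by
  by_contra! hlen
  cases c with
  | nil => simp at hc
  | @cons _ v _ h c =>
    rw [SimpleGraph.Walk.cons_isCycle_iff] at hc
    obtain ⟨g, hg⟩ := hG.1 h
    have hgs : s(p g, q g) = s(u, v) := by
      rw [Sym2.eq_iff]; exact hg
    have key : ∀ {a b : V} (r : G.Walk a b), s(u, v) ∉ r.edges → Conn p q {g}ᶜ r.length a b := by
      intro a b r
      induction r with
      | nil => exact fun _ => .refl ..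
      | @cons a a' b h r ih =>
        intro hr
        simp only [SimpleGraph.Walk.edges_cons, List.mem_cons, not_or] at hr
        obtain ⟨e, he⟩ := hG.1 h
        have hes : s(p e, q e) = s(a, a') := by
          rw [Sym2.eq_iff]; exact he
        have heg : e ∈ ({g}ᶜ : Set E) := by
          rintro rfl
          exact hr.1 (hgs.symm.trans hes)
        rcases he with ⟨rfl, rfl⟩ | ⟨rfl, rfl⟩
        · exact .fwd heg (ih hr.2)
        · exact .bwd heg (ih hr.2)
    have hlen' : c.length ≤ M := by simpa using hlen
    have h1 := (key c hc.2).mono hlen' le_rfl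
    refine hM g ?_
    rcases hg with ⟨rfl, rfl⟩ | ⟨rfl, rfl⟩
    · exact h1.symm
    · exact h1

open Classical in
/-- For any sizes `w` and degrees `d` satisfying the balance equations, there is a graph of large
girth whose vertices are partitioned into clusters of sizes `2 * w x` such that every vertex of the
cluster `x` has `d x y` neighbours in the cluster `y`. It is bipartite, with `w x` vertices of the
cluster `x` on either side, and found among the bipartite multigraphs in which the edges between
the left part of `x` and the right part of `y` are numbered from `0` to `w x * d x y - 1`. -/
theorem exists_graph_of_degrees {X : Type} [Fintype X] (w : X → ℕ) (d : X → X → ℕ) (Δ k : ℕ)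
    (hd : ∀ x y, w x * d x y = w y * d y x) (hΔ : ∀ x, ∑ y, d x y ≤ Δ)
    (hw : ∀ x, 2 * (Δ + 1) ^ (2 * k + 1) < w x) :
    ∃ (n : ℕ) (G : SimpleGraph (Fin n)) (cl : Fin n → X),
      n = 2 * ∑ x, w x ∧
      (∀ x, {v | cl v = x}.ncard = 2 * w x) ∧
      (∀ v y, {z | G.Adj v z ∧ cl z = y}.ncard = d (cl v) y) ∧
      ((2 * (k + 1) + 1 : ℕ) : ℕ∞) < G.egirth := by
  let V : Type := (Σ x, Fin (w x)) × Bool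
  let E : Type := Σ c : X × X, Fin (w c.1 * d c.1 c.2)
  let n := Fintype.card V
  let ψ : V ≃ Fin n := Fintype.equivFin V
  let p₀ : E → V := fun e => (⟨e.1.1, e.2.divNat⟩, false)
  let q₀ : E → V := fun e => (⟨e.1.2, (Fin.cast (hd e.1.1 e.1.2) e.2).divNat⟩, true)
  let p : E → Fin n := ψ ∘ p₀
  let q : E → Fin n := ψ ∘ q₀
  let κ : E → X × X := Sigma.fst
  let cl : Fin n → X := fun v => (ψ.symm v).1.1
  let sd : Fin n → Bool := fun v => (ψ.symm v).2
  have hV : ∀ {x : X} (i j : Fin (w x)) (b : Bool),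
      ((⟨x, i⟩, b) : (Σ x, Fin (w x)) × Bool) = (⟨x, j⟩, b) ↔ i = j := by
    intro x i j b
    rw [Prod.mk.injEq, Sigma.mk.injEq]
    simp
  have hclp : ∀ e, cl (p e) = (κ e).1 := fun e => by simp [cl, p, p₀, κ]
  have hclq : ∀ e, cl (q e) = (κ e).2 := fun e => by simp [cl, q, q₀, κ]
  have hsp : ∀ e, sd (p e) = false := fun e => by simp [sd, p, p₀]
  have hsq : ∀ e, sd (q e) = true := fun e => by simp [sd, q, q₀]
  have hpq : ∀ e e', p e ≠ q e' := fun e e' h => by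
    have := congrArg sd h
    rw [hsp, hsq] at this
    cases this
  have hclass : ∀ (x y : X) (P : E → Prop) [DecidablePred P], Finset.card {e | κ e = (x, y) ∧ P e} =
      Finset.card {i : Fin (w x * d x y) | P ⟨(x, y), i⟩} := by
    intro x y P _
    symm
    refine Finset.card_bij (fun i _ => (⟨(x, y), i⟩ : E)) ?_ ?_ ?_
    · intro i hi; simpa [κ] using hi
    · intro a _ b _ h; exact eq_of_heq (Sigma.mk.inj h).2
    · rintro ⟨c, i⟩ hb
      obtain ⟨h1, h2⟩ := (Finset.mem_filter.1 hb).2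
      obtain rfl : c = (x, y) := h1
      exact ⟨i, by simpa using h2, rfl⟩
  have hp : ∀ (x y : X) (v : Fin n), cl v = x → sd v = false →
      Finset.card {e | κ e = (x, y) ∧ p e = v} = d x y := by
    rintro _ y v rfl hv
    obtain ⟨⟨⟨x, j⟩, b⟩, rfl⟩ := ψ.surjective v
    obtain rfl : b = false := by simpa [sd] using hv
    simp only [cl, Equiv.symm_apply_apply]
    rw [hclass]
    refine Eq.trans ?_ (Fin.card_divNat_eq (n := d x y) j)
    refine congrArg Finset.card (Finset.filter_congr fun i _ => ?_)
    exact ψ.apply_eq_iff_eq.trans (hV _ _ _)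
  have hq : ∀ (x y : X) (v : Fin n), cl v = y → sd v = true →
      Finset.card {e | κ e = (x, y) ∧ q e = v} = d y x := by
    rintro x _ v rfl hv
    obtain ⟨⟨⟨y, j⟩, b⟩, rfl⟩ := ψ.surjective v
    obtain rfl : b = true := by simpa [sd] using hv
    simp only [cl, Equiv.symm_apply_apply]
    rw [hclass]
    refine Eq.trans ?_ (Fin.card_divNat_eq (n := d y x) j)
    refine Finset.card_bij (fun i _ => Fin.cast (hd x y) i) ?_ ?_ ?_
    · intro i hi
      have hi := (Finset.mem_filter.1 hi).2
      exact Finset.mem_filter.2 ⟨Finset.mem_univ _, (ψ.apply_eq_iff_eq.trans (hV _ _ _)).1 hi⟩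
    · intro a _ b _ h; simpa using h
    · intro b hb
      have hb := (Finset.mem_filter.1 hb).2
      exact ⟨Fin.cast (hd x y).symm b, Finset.mem_filter.2 ⟨Finset.mem_univ _,
        (ψ.apply_eq_iff_eq.trans (hV _ _ _)).2 hb⟩, rfl⟩
  have hpd : ∀ (x y : X) (v : Fin n), Finset.card {e | κ e = (x, y) ∧ p e = v} ≤ d x y := by
    intro x y v
    by_cases h : cl v = x ∧ sd v = false
    · exact (hp x y v h.1 h.2).le
    · rw [Finset.card_eq_zero.2]
      · exact Nat.zero_le _
      · rw [Finset.filter_eq_empty_iff]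
        rintro e - ⟨h1, rfl⟩
        exact h ⟨by rw [hclp, h1], hsp e⟩
  have hqd : ∀ (x y : X) (v : Fin n), Finset.card {e | κ e = (x, y) ∧ q e = v} ≤ d y x := by
    intro x y v
    by_cases h : cl v = y ∧ sd v = true
    · exact (hq x y v h.1 h.2).le
    · rw [Finset.card_eq_zero.2]
      · exact Nat.zero_le _
      · rw [Finset.filter_eq_empty_iff]
        rintro e - ⟨h1, rfl⟩
        exact h ⟨by rw [hclq, h1], hsq e⟩
  have hdeg : ∀ v, Finset.card {e | p e = v} + Finset.card {e | q e = v} ≤ Δ := by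
    intro v
    refine le_trans ?_ (hΔ (cl v))
    cases hv : sd v
    · have h0 : (Finset.univ.filter fun e => q e = v) = ∅ := by
        rw [Finset.filter_eq_empty_iff]
        rintro e - rfl
        rw [hsq] at hv; cases hv
      rw [h0, Finset.card_empty, add_zero]
      refine (Finset.card_le_card (t := Finset.univ.biUnion fun y =>
        Finset.univ.filter fun e => κ e = (cl v, y) ∧ p e = v) ?_).trans
        (Finset.card_biUnion_le.trans (Finset.sum_le_sum fun y _ => hpd _ _ _))
      intro e he
      have he := (Finset.mem_filter.1 he).2
      subst he
      simp only [Finset.mem_biUnion, Finset.mem_univ, Finset.mem_filter, true_and, and_true]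
      exact ⟨(κ e).2, by rw [hclp]⟩
    · have h0 : (Finset.univ.filter fun e => p e = v) = ∅ := by
        rw [Finset.filter_eq_empty_iff]
        rintro e - rfl
        rw [hsp] at hv; cases hv
      rw [h0, Finset.card_empty, zero_add]
      refine (Finset.card_le_card (t := Finset.univ.biUnion fun y =>
        Finset.univ.filter fun e => κ e = (y, cl v) ∧ q e = v) ?_).trans
        (Finset.card_biUnion_le.trans (Finset.sum_le_sum fun y _ => hqd _ _ _))
      intro e he
      have he := (Finset.mem_filter.1 he).2
      subst he
      simp only [Finset.mem_biUnion, Finset.mem_univ, Finset.mem_filter, true_and, and_true]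
      exact ⟨(κ e).1, by rw [hclq]⟩
  have hmeet : ∀ (r : E → Fin n) (c : X × X) (D : ℕ) (T : Finset (Fin n)),
      (∀ v, Finset.card {e | κ e = c ∧ r e = v} ≤ D) →
      Finset.card {e | κ e = c ∧ r e ∈ T} ≤ T.card * D := by
    intro r c D T h
    refine (Finset.card_le_card (t := T.biUnion fun v =>
      Finset.univ.filter fun e => κ e = c ∧ r e = v) ?_).trans
      (Finset.card_biUnion_le_card_mul _ _ _ fun v _ => h v)
    intro e he
    simpa [and_comm] using he
  obtain ⟨σ, hσκ, hσ⟩ := exists_perm_not_onShortCycle p q κ Δ (2 * k + 1) hpq hdeg (by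
    intro e T hT
    obtain ⟨⟨x, y⟩, i⟩ := e
    have hcard : Finset.card {f : E | κ f = (x, y)} = w x * d x y := by
      have := hclass x y fun _ => True
      simpa using this
    have hpos : 0 < w x * d x y := i.pos
    have hdx : 0 < d x y := Nat.pos_of_mul_pos_left hpos
    have hdy : 0 < d y x := Nat.pos_of_mul_pos_left (hd x y ▸ hpos)
    have hTx : 2 * T.card < w x := lt_of_le_of_lt (Nat.mul_le_mul_left 2 hT) (hw x)
    have hTy : 2 * T.card < w y := lt_of_le_of_lt (Nat.mul_le_mul_left 2 hT) (hw y)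
    change 2 * Finset.card {f | κ f = (x, y) ∧ p f ∈ T} < Finset.card {f | κ f = (x, y)} ∧
      2 * Finset.card {f | κ f = (x, y) ∧ q f ∈ T} < Finset.card {f | κ f = (x, y)}
    rw [hcard]
    constructor
    · have h1 := hmeet p (x, y) (d x y) T (hpd x y)
      have h2 := Nat.mul_lt_mul_of_pos_right hTx hdx
      rw [mul_assoc] at h2
      omega
    · have h1 := hmeet q (x, y) (d y x) T (hqd x y)
      have h2 := Nat.mul_lt_mul_of_pos_right hTy hdy
      rw [mul_assoc, ← hd x y] at h2
      omega)
  have hσp : ∀ (c : X × X) (v : Fin n), Finset.card {e | κ e = c ∧ p (σ e) = v} =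
      Finset.card {e | κ e = c ∧ p e = v} := by
    intro c v
    refine Finset.card_bij (fun f _ => σ f) ?_ ?_ ?_
    · intro f hf; simpa [hσκ] using hf
    · intro a _ b _ h; exact σ.injective h
    · intro b hb
      have := hσκ (σ.symm b)
      rw [Equiv.apply_symm_apply] at this
      exact ⟨σ.symm b, by simpa [← this] using hb, by simp⟩
  -- there are no parallel edges
  have hinj : ∀ e f, p (σ e) = p (σ f) → q e = q f → e = f := by
    intro e f h1 h2
    by_contra hne
    refine hσ e ?_
    have h3 : Conn (p ∘ σ) q {e}ᶜ 1 ((p ∘ σ) f) (q f) :=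
      .fwd (by simpa [eq_comm] using hne) (.refl ..)
    rw [OnShortCycle, Function.comp_apply, h1, h2]
    exact h3.mono (by omega) le_rfl
  let A : Fin n → Fin n → Prop := fun a b => ∃ e, (p (σ e) = a ∧ q e = b) ∨ (p (σ e) = b ∧ q e = a)
  have hAs : ∀ a b, A a b → A b a := fun a b ⟨e, h⟩ => ⟨e, h.symm⟩
  have hAl : ∀ a, ¬ A a a := by
    rintro a ⟨e, ⟨h1, h2⟩ | ⟨h1, h2⟩⟩
    · exact hpq _ _ (h1.trans h2.symm)
    · exact hpq _ _ (h1.trans h2.symm)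
  have hcount : ∀ v y, Finset.card {z | A v z ∧ cl z = y} = d (cl v) y := by
    intro v y
    cases hv : sd v
    · rw [← hp (cl v) y v rfl hv, ← hσp]
      symm
      refine Finset.card_bij (fun e _ => q e) ?_ ?_ ?_
      · intro e he
        obtain ⟨h1, h2⟩ := (Finset.mem_filter.1 he).2
        simp only [Finset.mem_filter, Finset.mem_univ, true_and]
        exact ⟨⟨e, .inl ⟨h2, rfl⟩⟩, by rw [hclq, h1]⟩
      · intro e he f hf h
        obtain ⟨-, he⟩ := (Finset.mem_filter.1 he).2
        obtain ⟨-, hf⟩ := (Finset.mem_filter.1 hf).2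
        exact hinj e f (he.trans hf.symm) h
      · intro z hz
        rw [Finset.mem_filter] at hz
        obtain ⟨-, ⟨e, h⟩, h2⟩ := hz
        rcases h with ⟨h3, rfl⟩ | ⟨h3, h4⟩
        · refine ⟨e, ?_, rfl⟩
          simp only [Finset.mem_filter, Finset.mem_univ, true_and]
          refine ⟨?_, h3⟩
          rw [← h2, ← h3, hclp, hclq, hσκ]
        · rw [← h4, hsq] at hv; cases hv
    · rw [← hq y (cl v) v rfl hv]
      symm
      refine Finset.card_bij (fun e _ => p (σ e)) ?_ ?_ ?_
      · intro e he
        obtain ⟨h1, h2⟩ := (Finset.mem_filter.1 he).2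
        simp only [Finset.mem_filter, Finset.mem_univ, true_and]
        exact ⟨⟨e, .inr ⟨rfl, h2⟩⟩, by rw [hclp, hσκ, h1]⟩
      · intro e he f hf h
        obtain ⟨-, he⟩ := (Finset.mem_filter.1 he).2
        obtain ⟨-, hf⟩ := (Finset.mem_filter.1 hf).2
        exact hinj e f h (he.trans hf.symm)
      · intro z hz
        rw [Finset.mem_filter] at hz
        obtain ⟨-, ⟨e, h⟩, h2⟩ := hz
        rcases h with ⟨h3, h4⟩ | ⟨h3, h4⟩
        · rw [← h3, hsp] at hv; cases hv
        · refine ⟨e, ?_, h3⟩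
          simp only [Finset.mem_filter, Finset.mem_univ, true_and]
          refine ⟨?_, h4⟩
          rw [← h2, ← h3, ← h4, hclp, hclq, hσκ]
  let G : SimpleGraph (Fin n) := { Adj := A, symm := ⟨hAs⟩, loopless := ⟨hAl⟩ }
  refine ⟨n, G, cl, ?_, ?_, ?_, ?_⟩
  · simp [n, V, mul_comm]
  · intro x
    have : {v | cl v = x}.ncard = Finset.card {v : V | v.1.1 = x} := by
      rw [Set.ncard_eq_toFinset_card']
      refine Finset.card_bij (fun v _ => ψ.symm v) ?_ ?_ ?_
      · intro v hv; simpa [cl] using hv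
      · intro a _ b _ h; exact ψ.symm.injective h
      · intro b hb; exact ⟨ψ b, by simpa [cl] using hb, by simp⟩
    rw [this, show 2 * w x = (Finset.univ : Finset (Fin (w x) × Bool)).card by simp [mul_comm]]
    symm
    refine Finset.card_bij (fun i _ => ((⟨x, i.1⟩, i.2) : V)) ?_ ?_ ?_
    · intro i _; simp
    · rintro ⟨a, b⟩ _ ⟨a', b'⟩ _ h
      obtain ⟨h1, h2⟩ := Prod.mk.inj h
      exact Prod.ext (eq_of_heq (Sigma.mk.inj h1).2) h2
    · rintro ⟨⟨y, i⟩, b⟩ h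
      obtain rfl : y = x := by simpa using h
      exact ⟨(i, b), by simp, rfl⟩
  · intro v y
    rw [← hcount v y, Set.ncard_eq_toFinset_card']
    congr 1
    ext z
    simp [G]
  · -- cycles have even length, as the graph is bipartite
    let col : G.Coloring Bool := SimpleGraph.Coloring.mk sd (by
      rintro a b ⟨e, ⟨rfl, rfl⟩ | ⟨rfl, rfl⟩⟩ <;> simp [hsp, hsq])
    have hlow : ((2 * (k + 1) + 2 : ℕ) : ℕ∞) ≤ G.egirth := by
      rw [SimpleGraph.le_egirth]
      intro u c hc
      have h1 := egirth_of_not_onShortCycle (p := p ∘ σ) (q := q) (G := G) Iff.rfl hσ u c hc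
      have h2 : Even c.length := (col.even_length_iff_congr c).2 Iff.rfl
      obtain ⟨l, hl⟩ := h2
      have : 2 * (k + 1) + 2 ≤ c.length := by omega
      exact_mod_cast this
    exact lt_of_lt_of_le (by exact_mod_cast Nat.lt_succ_self _) hlow

/-! ### The cluster tree -/

/-- The stage of a node of a tree, where a node is encoded by the labels of the arcs on the way from
it to the root. The stage grows along every arc away from the root. -/
def stage : List ℕ → ℕ
  | [] => 0
  | l :: t => max (stage t + 1) l

/-- The label of the arc from a cluster to its parent; `0` at the root. -/
def upLabel : List ℕ → ℕ
  | [] => 0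
  | l :: _ => l + 1

/-- The cluster tree of height `K`: every cluster of stage less than `K` has one child for each
label in `{1, …, K}` other than the label of the arc to its parent. -/
def IsCluster (K : ℕ) : List ℕ → Prop
  | [] => True
  | l :: t => IsCluster K t ∧ stage t < K ∧ 1 ≤ l ∧ l ≤ K ∧ l ≠ upLabel t

/-- The label of the arc from `x` to `y`. The label `0` stands for the loops: every vertex has one
neighbour in its own cluster. -/
def arcLabel (x y : List ℕ) : ℕ :=
  if x = y then 0 else if x ≠ [] ∧ x.tail = y then upLabel x else upLabel y - 1

/-- The number of neighbours in the cluster `y` of a vertex of the cluster `x`. It is `δ ^ (l - 1)`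
where `l` is the label of the arc from `x` to `y`. (This is `1` for loops, by truncated
subtraction.) -/
def clusterDeg (δ : ℕ) (x y : List ℕ) : ℕ :=
  if x = y ∨ (x ≠ [] ∧ x.tail = y) ∨ (y ≠ [] ∧ y.tail = x) then δ ^ (arcLabel x y - 1) else 0

theorem IsCluster.stage_le {K : ℕ} {x : List ℕ} (h : IsCluster K x) : stage x ≤ K := by
  cases x with
  | nil => exact Nat.zero_le _
  | cons l t =>
    obtain ⟨_, h1, _, h2, _⟩ := h
    exact max_le h1 h2

theorem IsCluster.tail {K : ℕ} {x : List ℕ} (h : IsCluster K x) : IsCluster K x.tail := by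
  cases x with
  | nil => exact h
  | cons l t => exact h.1

theorem upLabel_le (x : List ℕ) : upLabel x ≤ stage x + 1 := by
  cases x with
  | nil => exact Nat.zero_le _
  | cons l t => exact Nat.succ_le_succ (le_max_right _ _)

theorem length_le_stage (x : List ℕ) : x.length ≤ stage x := by
  induction x with
  | nil => exact le_rfl
  | cons l t ih => exact (Nat.succ_le_succ ih).trans (le_max_left _ _)

theorem IsCluster.mem_le {K : ℕ} {x : List ℕ} (h : IsCluster K x) : ∀ l ∈ x, l ≤ K := by
  induction x with
  | nil => simp
  | cons a t ih =>
    intro l hl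
    rcases List.mem_cons.1 hl with rfl | hl
    · exact h.2.2.2.1
    · exact ih h.1 l hl

theorem finite_isCluster (K : ℕ) : {x | IsCluster K x}.Finite := by
  refine ((List.finite_length_le (Fin (K + 1)) K).image (List.map Fin.val)).subset ?_
  intro x hx
  have hx : IsCluster K x := hx
  refine ⟨x.map (Fin.ofNat (K + 1)), ?_, ?_⟩
  · simpa using (length_le_stage x).trans hx.stage_le
  · rw [List.map_map]
    conv_rhs => rw [← List.map_id x]
    refine List.map_congr_left fun l hl => ?_
    have := hx.mem_le l hl
    simpa using this

instance (K : ℕ) : Finite {x // IsCluster K x} := finite_isCluster K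

@[simp] theorem arcLabel_self (x : List ℕ) : arcLabel x x = 0 := if_pos rfl

@[simp] theorem arcLabel_tail (l : ℕ) (t : List ℕ) : arcLabel (l :: t) t = l + 1 := by
  simp [arcLabel, upLabel]

@[simp] theorem arcLabel_child (l : ℕ) (t : List ℕ) : arcLabel t (l :: t) = l := by
  have h : ¬ (t ≠ [] ∧ t.tail = l :: t) := by
    rintro ⟨-, h⟩
    have := congrArg List.length h
    simp at this
  simp [arcLabel, upLabel, h]

@[simp] theorem clusterDeg_self (δ : ℕ) (x : List ℕ) : clusterDeg δ x x = 1 := by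
  simp [clusterDeg]

@[simp] theorem clusterDeg_tail (δ l : ℕ) (t : List ℕ) : clusterDeg δ (l :: t) t = δ ^ l := by
  simp [clusterDeg]

@[simp] theorem clusterDeg_child (δ l : ℕ) (t : List ℕ) :
    clusterDeg δ t (l :: t) = δ ^ (l - 1) := by
  simp [clusterDeg]

/-- The three kinds of arcs: loops, arcs to the parent, arcs to a child. -/
theorem clusterDeg_ne_zero {δ : ℕ} {x y : List ℕ} (h : clusterDeg δ x y ≠ 0) :
    x = y ∨ (∃ l, x = l :: y) ∨ ∃ l, y = l :: x := by
  unfold clusterDeg at h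
  split_ifs at h with h1
  · rcases h1 with h1 | ⟨h1, h2⟩ | ⟨h1, h2⟩
    · exact .inl h1
    · cases x with
      | nil => exact absurd rfl h1
      | cons l t => exact .inr (.inl ⟨l, by simpa using h2⟩)
    · cases y with
      | nil => exact absurd rfl h1
      | cons l t => exact .inr (.inr ⟨l, by simpa using h2⟩)
  · exact absurd rfl h

/-! ### Clusters that cannot be told apart -/

/-- Vertices of the clusters `x` and `y` look alike up to distance `r`: either the stages of both
clusters are small, or both have the same stage and the same label at the arc to the parent, and
the parents look alike up to distance `r - 1`. -/
inductive Alike (K : ℕ) : ℕ → List ℕ → List ℕ → Prop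
  | low {r : ℕ} {x y : List ℕ} : stage x + r < K → stage y + r < K → Alike K r x y
  | zero {l : ℕ} {x y : List ℕ} : stage (l :: x) = stage (l :: y) → Alike K 0 (l :: x) (l :: y)
  | cons {r l : ℕ} {x y : List ℕ} : stage (l :: x) = stage (l :: y) → Alike K r x y →
      Alike K (r + 1) (l :: x) (l :: y)

theorem Alike.of_succ {K r : ℕ} {x y : List ℕ} (h : Alike K (r + 1) x y) : Alike K r x y := by
  induction r generalizing x y with
  | zero =>
    cases h with
    | low h1 h2 => exact .low (by omega) (by omega)
    | cons h1 _ => exact .zero h1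
  | succ r ih =>
    cases h with
    | low h1 h2 => exact .low (by omega) (by omega)
    | cons h1 h2 => exact .cons h1 (ih h2)

theorem Alike.succ_cases {K r : ℕ} {x y : List ℕ} (h : Alike K (r + 1) x y) :
    (stage x + (r + 1) < K ∧ stage y + (r + 1) < K) ∨
      ∃ l t t', x = l :: t ∧ y = l :: t' ∧ stage x = stage y ∧ Alike K r t t' := by
  cases h with
  | low h1 h2 => exact .inl ⟨h1, h2⟩
  | cons h1 h2 => exact .inr ⟨_, _, _, rfl, rfl, h1, h2⟩

/-- The number of neighbours along arcs labelled `l` of a vertex in a cluster `x`. -/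
def labelDeg (K δ : ℕ) (x : List ℕ) (l : ℕ) : ℕ :=
  if l = 0 ∨ l = upLabel x ∨ (stage x < K ∧ l ≤ K) then δ ^ (l - 1) else 0

theorem Alike.labelDeg_eq {K r δ : ℕ} {x y : List ℕ} (h : Alike K r x y) (l : ℕ) :
    labelDeg K δ x l = labelDeg K δ y l := by
  have key : ∀ {x}, stage x < K → labelDeg K δ x l = if l ≤ K then δ ^ (l - 1) else 0 := by
    intro x hx
    have := upLabel_le x
    unfold labelDeg
    refine if_congr ⟨?_, fun h => .inr (.inr ⟨hx, h⟩)⟩ rfl rfl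
    rintro (h | h | h) <;> omega
  cases h with
  | low h1 h2 => rw [key (by omega), key (by omega)]
  | zero h1 => exact if_congr (by simp only [upLabel, h1]) rfl rfl
  | cons h1 _ => exact if_congr (by simp only [upLabel, h1]) rfl rfl

/-- The vertices of `G` are partitioned into the clusters of the cluster tree of height `K`, and
the numbers of neighbours in each cluster are as prescribed by `clusterDeg`. -/
structure IsClusterGraph {V : Type} [Fintype V] (G : SimpleGraph V) (K δ : ℕ)
    (cl : V → List ℕ) : Prop where
  isCluster : ∀ v, IsCluster K (cl v)
  ncard_eq : ∀ v y, IsCluster K y → {z | G.Adj v z ∧ cl z = y}.ncard = clusterDeg δ (cl v) y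

namespace IsClusterGraph

variable {V : Type} [Fintype V] {G : SimpleGraph V} {K δ : ℕ} {cl : V → List ℕ}

theorem arc_cases (hG : IsClusterGraph G K δ cl) {v w : V} (h : G.Adj v w) :
    cl v = cl w ∨ (∃ l, cl v = l :: cl w) ∨ ∃ l, cl w = l :: cl v := by
  refine clusterDeg_ne_zero (δ := δ) fun h0 => ?_
  rw [← hG.ncard_eq v _ (hG.isCluster w), Set.ncard_eq_zero] at h0
  exact Set.eq_empty_iff_forall_notMem.1 h0 w ⟨h, rfl⟩

theorem ncard_arcLabel_eq (hG : IsClusterGraph G K δ cl) (v : V) (l : ℕ) :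
    {z | G.Adj v z ∧ arcLabel (cl v) (cl z) = l}.ncard = labelDeg K δ (cl v) l := by
  have hv := hG.isCluster v
  -- the arcs labelled `l` lead to a single cluster `y`
  have key : ∀ y, IsCluster K y → arcLabel (cl v) y = l →
      (∀ z, G.Adj v z → arcLabel (cl v) (cl z) = l → cl z = y) →
      {z | G.Adj v z ∧ arcLabel (cl v) (cl z) = l}.ncard = clusterDeg δ (cl v) y := by
    intro y hy hl h
    rw [← hG.ncard_eq v y hy]
    congr 1
    ext z
    exact ⟨fun hz => ⟨hz.1, h z hz.1 hz.2⟩, fun hz => ⟨hz.1, by rw [hz.2, hl]⟩⟩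
  have hchild : ∀ {z m}, cl z = m :: cl v →
      1 ≤ m ∧ m ≤ K ∧ m ≠ upLabel (cl v) ∧ stage (cl v) < K := by
    intro z m h
    have := hG.isCluster z
    rw [h] at this
    exact ⟨this.2.2.1, this.2.2.2.1, this.2.2.2.2, this.2.1⟩
  by_cases h0 : l = 0
  · subst h0
    rw [key (cl v) hv (by simp), clusterDeg_self, labelDeg, if_pos (.inl rfl)]
    · rfl
    · intro z hz hl
      rcases hG.arc_cases hz with h | ⟨m, h⟩ | ⟨m, h⟩
      · exact h.symm
      · rw [h] at hl; simp at hl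
      · rw [h] at hl
        have := hchild h
        simp at hl
        omega
  by_cases h1 : l = upLabel (cl v)
  · obtain ⟨m, t, hm⟩ : ∃ m t, cl v = m :: t := by
      cases hc : cl v with
      | nil => rw [hc] at h1; exact absurd h1 h0
      | cons m t => exact ⟨m, t, rfl⟩
    have hlm : l = m + 1 := by rw [h1, hm]; rfl
    rw [key t (by rw [hm] at hv; exact hv.1) (by rw [hm, hlm]; simp), labelDeg,
      if_pos (.inr (.inl h1)), hm, clusterDeg_tail, hlm, Nat.add_sub_cancel]
    intro z hz hl
    rcases hG.arc_cases hz with h | ⟨m', h⟩ | ⟨m', h⟩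
    · rw [h] at hl; simp at hl; omega
    · rw [hm] at h; injection h with _ h; exact h.symm
    · rw [h] at hl
      have := hchild h
      simp at hl
      omega
  by_cases h2 : stage (cl v) < K ∧ l ≤ K
  · rw [key (l :: cl v) ⟨hv, h2.1, by omega, h2.2, h1⟩ (by simp), clusterDeg_child, labelDeg,
      if_pos (.inr (.inr h2))]
    intro z hz hl
    rcases hG.arc_cases hz with h | ⟨m', h⟩ | ⟨m', h⟩
    · rw [h] at hl; simp at hl; omega
    · rw [h] at hl h1; simp at hl; exact absurd hl.symm h1
    · rw [h] at hl; simp at hl; rw [h, hl]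
  · rw [labelDeg, if_neg (by tauto), Set.ncard_eq_zero, Set.eq_empty_iff_forall_notMem]
    rintro z ⟨hz, hl⟩
    rcases hG.arc_cases hz with h | ⟨m', h⟩ | ⟨m', h⟩
    · rw [h] at hl; simp at hl; omega
    · rw [h] at hl h1; simp at hl; exact absurd hl.symm h1
    · rw [h] at hl; simp at hl
      have := hchild h
      omega

open Classical in
/-- If vertices of two clusters have equally many neighbours along the arcs of each label, and the
type of a neighbour depends only on that label, then the multisets of types agree. -/
theorem map_branchType_eq (hG : IsClusterGraph G K δ cl) {r : ℕ} {w w' : V}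
    (hA : Alike K r (cl w) (cl w'))
    (h : ∀ {v v' z z'}, G.Adj v z → G.Adj v' z' → Alike K r (cl v) (cl v') →
      arcLabel (cl v) (cl z) = arcLabel (cl v') (cl z') →
      branchType G r v z = branchType G r v' z') :
    (G.neighborFinset w).val.map (branchType G r w) =
      (G.neighborFinset w').val.map (branchType G r w') := by
  have hcnt : ∀ v l, ((G.neighborFinset v).val.map fun z => arcLabel (cl v) (cl z)).count l =
      labelDeg K δ (cl v) l := by
    intro v l
    rw [← hG.ncard_arcLabel_eq v l, Multiset.count_map, Set.ncard_eq_toFinset_card']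
    change (Finset.filter _ _).card = _
    congr 1
    ext z
    simp [eq_comm]
  have hlab : (G.neighborFinset w).val.map (fun z => arcLabel (cl w) (cl z)) =
      (G.neighborFinset w').val.map fun z => arcLabel (cl w') (cl z) := by
    ext l
    rw [hcnt, hcnt, hA.labelDeg_eq]
  obtain ⟨P, hP1, hP2, hP3, hP4⟩ := Finset.exists_bij_of_map_eq _ _ _ _ hlab
  choose! f hf using hP3
  refine Multiset.map_eq_map_of_bij_of_nodup _ _ (G.neighborFinset w).nodup
    (G.neighborFinset w').nodup (fun a _ => f a) ?_ ?_ ?_ ?_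
  · intro a ha; exact (hP1 (hf a ha)).2.1
  · intro a ha b hb hab; exact (hP2 (hf a ha) (hf b hb)).2 hab
  · intro b hb
    obtain ⟨a, ha⟩ := hP4 b hb
    have ha' := (hP1 ha).1
    exact ⟨a, ha', (hP2 (hf a ha') ha).1 rfl⟩
  · intro a ha
    obtain ⟨h1, h2, h3⟩ := hP1 (hf a ha)
    exact h (by simpa using h1) (by simpa using h2) hA h3

theorem branchType_succ_eq (hG : IsClusterGraph G K δ cl) {r : ℕ} {v w v' w' : V}
    (hvw : G.Adj v w) (hvw' : G.Adj v' w') (hA : Alike K r (cl w) (cl w'))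
    (h : ∀ {v v' z z'}, G.Adj v z → G.Adj v' z' → Alike K r (cl v) (cl v') →
      arcLabel (cl v) (cl z) = arcLabel (cl v') (cl z') →
      branchType G r v z = branchType G r v' z')
    (hret : branchType G r w v = branchType G r w' v') :
    branchType G (r + 1) v w = branchType G (r + 1) v' w' := by
  classical
  have h1 := hG.map_branchType_eq hA h
  simp only [branchType]
  rw [Multiset.map_erase_of_mem (branchType G r w) _ (by simpa using hvw.symm),
    Multiset.map_erase_of_mem (branchType G r w') _ (by simpa using hvw'.symm), hret]
  exact congrArg (fun s : Multiset (BranchType r) => s.erase _) (by convert h1)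

/-- The type of a branch entered from a cluster `x` depends only on the label of the arc and on `x`
up to `Alike`; moreover all branches between clusters of small stage have the same type. The second
part is where the reverse labels of an arc, which differ, are seen not to matter: the branch loses
one sub-branch at the arc it is entered through, and all candidates for it have the same type. -/
theorem branchType_eq (hG : IsClusterGraph G K δ cl) (r : ℕ) {v w v' w' : V}
    (hvw : G.Adj v w) (hvw' : G.Adj v' w') :
    (Alike K r (cl v) (cl v') → arcLabel (cl v) (cl w) = arcLabel (cl v') (cl w') →
      branchType G r v w = branchType G r v' w') ∧
    (stage (cl w) + r ≤ K → stage (cl w') + r ≤ K → stage (cl v) + r ≤ K + 1 →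
      stage (cl v') + r ≤ K + 1 → branchType G r v w = branchType G r v' w') := by
  induction r generalizing v w v' w' with
  | zero => exact ⟨fun _ _ => rfl, fun _ _ _ _ => rfl⟩
  | succ r ih =>
    have ihA : ∀ {v v' z z'}, G.Adj v z → G.Adj v' z' → Alike K r (cl v) (cl v') →
        arcLabel (cl v) (cl z) = arcLabel (cl v') (cl z') →
        branchType G r v z = branchType G r v' z' := fun h h' => (ih h h').1
    have hB : stage (cl w) + (r + 1) ≤ K → stage (cl w') + (r + 1) ≤ K →
        stage (cl v) + (r + 1) ≤ K + 1 → stage (cl v') + (r + 1) ≤ K + 1 →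
        branchType G (r + 1) v w = branchType G (r + 1) v' w' := by
      intro h1 h2 h3 h4
      exact hG.branchType_succ_eq hvw hvw' (.low (by omega) (by omega)) ihA
        ((ih hvw.symm hvw'.symm).2 (by omega) (by omega) (by omega) (by omega))
    refine ⟨fun hA hl => ?_, hB⟩
    -- it suffices that the entered clusters are alike and are left by the same label
    have step : Alike K r (cl w) (cl w') → arcLabel (cl w) (cl v) = arcLabel (cl w') (cl v') →
        branchType G (r + 1) v w = branchType G (r + 1) v' w' := fun h1 h2 =>
      hG.branchType_succ_eq hvw hvw' h1 ihA (ihA hvw.symm hvw'.symm h1 h2)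
    have hst : ∀ {v w}, G.Adj v w →
        stage (cl w) ≤ max (stage (cl v) + 1) (arcLabel (cl v) (cl w)) := by
      intro v w h
      rcases hG.arc_cases h with h | ⟨m, h⟩ | ⟨m, h⟩
      · rw [h]; exact (Nat.le_succ _).trans (le_max_left _ _)
      · rw [h, stage]
        exact le_max_of_le_left (by have := le_max_left (stage (cl w) + 1) m; omega)
      · rw [h]; simp [stage]
    have hchild : ∀ {v w}, G.Adj v w → stage (cl v) + 1 < arcLabel (cl v) (cl w) →
        cl w = arcLabel (cl v) (cl w) :: cl v := by
      intro v w h hlt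
      rcases hG.arc_cases h with h | ⟨m, h⟩ | ⟨m, h⟩
      · rw [h] at hlt; simp at hlt
      · have := upLabel_le (cl v)
        rw [h] at hlt this
        simp [upLabel] at hlt this
        omega
      · rw [h]; simp
    rcases hA.succ_cases with ⟨h1, h2⟩ | ⟨m, t, t', hx, hy, h1, h2⟩
    · have h3 := hst hvw
      have h4 := hst hvw'
      by_cases hle : arcLabel (cl v) (cl w) + (r + 1) ≤ K
      · refine hB ?_ ?_ (by omega) (by omega)
        · rcases le_max_iff.1 h3 with h | h <;> omega
        · rcases le_max_iff.1 h4 with h | h <;> omega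
      · have h5 := hchild hvw (by omega)
        have h6 := hchild hvw' (by omega)
        rw [← hl] at h6
        refine step ?_ ?_
        · rw [h5, h6]
          refine (Alike.cons ?_ (.low (by omega) (by omega))).of_succ
          simp only [stage]
          omega
        · rw [h5, h6]; simp
    · have hne : ∀ {v w a}, cl w = a :: cl v → a ≠ 0 ∧ a ≠ upLabel (cl v) := by
        intro v w a h
        have h5 := hG.isCluster w
        rw [h] at h5
        exact ⟨Nat.one_le_iff_ne_zero.1 h5.2.2.1, h5.2.2.2.2⟩
      rcases hG.arc_cases hvw with h | ⟨a, h⟩ | ⟨a, h⟩ <;>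
        rcases hG.arc_cases hvw' with h' | ⟨a', h'⟩ | ⟨a', h'⟩
      · refine step ?_ ?_
        · rw [← h, ← h']; exact hA.of_succ
        · rw [← h, ← h']; simp
      · rw [h, h'] at hl; simp at hl
      · rw [h, h'] at hl; simp at hl; exact absurd hl.symm (hne h').1
      · rw [h, h'] at hl; simp at hl
      · rw [h] at hx
        rw [h'] at hy
        injection hx with hx1 hx2
        injection hy with hy1 hy2
        refine step ?_ ?_
        · rw [hx2, hy2]; exact h2
        · rw [h, h', hx1, hy1]; simp
      · rw [h, h'] at hl; simp at hl
        refine absurd hl.symm ?_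
        have := (hne h').2
        rw [h] at hx
        injection hx with hx1 hx2
        rw [hy] at this
        rw [hx1]
        exact this
      · rw [h, h'] at hl; simp at hl; exact absurd hl (hne h).1
      · rw [h, h'] at hl; simp at hl
        refine absurd hl ?_
        have := (hne h).2
        rw [h'] at hy
        injection hy with hy1 hy2
        rw [hx] at this
        rw [hy1]
        exact this
      · rw [h, h'] at hl; simp at hl
        subst hl
        refine step ?_ ?_
        · rw [h, h']
          refine (Alike.cons ?_ hA).of_succ.of_succ
          simp only [stage, h1]
        · rw [h, h']; simp

end IsClusterGraph

/-! ### Fractional and integral matchings -/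

section Matchings

variable {V : Type} [Fintype V] {G : SimpleGraph V}

open Classical in
theorem sum_sum_mem_edge (y : G.edgeSet → ℝ) :
    ∑ v : V, ∑ e : G.edgeSet with v ∈ e.1, y e = 2 * edgeValue G y := by
  simp only [Finset.sum_filter]
  rw [Finset.sum_comm, edgeValue, Finset.mul_sum]
  refine Finset.sum_congr rfl fun e _ => ?_
  rw [← Finset.sum_filter, Finset.sum_const, nsmul_eq_mul]
  congr 1
  have h := Sym2.card_toFinset_of_not_isDiag e.1 (G.not_isDiag_of_mem_edgeSet e.2)
  have h2 : (Finset.univ.filter fun v => v ∈ e.1) = e.1.toFinset := by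
    ext v; simp
  rw [h2, h]
  norm_num

theorem edgeValue_le_of_mem_fractionalMatchings {y : G.edgeSet → ℝ}
    (hy : y ∈ fractionalMatchings G) : edgeValue G y ≤ Fintype.card V / 2 := by
  have h := Finset.sum_le_sum fun v (_ : v ∈ Finset.univ) => hy.2 v
  rw [sum_sum_mem_edge, Finset.sum_const, Finset.card_univ, nsmul_eq_mul, mul_one] at h
  linarith

theorem integralMatchings_subset : integralMatchings G ⊆ fractionalMatchings G := by
  classical
  rintro y ⟨M, hM, rfl⟩
  refine ⟨fun e => by dsimp only; split_ifs <;> norm_num, fun v => ?_⟩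
  rw [Finset.sum_ite, Finset.sum_const_zero, add_zero, Finset.sum_const, nsmul_eq_mul, mul_one]
  norm_cast
  rw [Finset.card_le_one]
  intro a ha b hb
  simp only [Finset.mem_filter, Finset.mem_univ, true_and] at ha hb
  apply Subtype.ext
  obtain ⟨w, hw⟩ := Sym2.mem_iff_exists.1 ha.1
  obtain ⟨w', hw'⟩ := Sym2.mem_iff_exists.1 hb.1
  rw [hw, hw']
  have h1 : M.Adj v w := by rw [← SimpleGraph.Subgraph.mem_edgeSet, ← hw]; exact ha.2
  have h2 : M.Adj v w' := by rw [← SimpleGraph.Subgraph.mem_edgeSet, ← hw']; exact hb.2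
  rw [(hM (M.edge_vert h1)).unique h1 h2]

/-- A graph with a perfect matching has optimum at least half its number of vertices, in both the
fractional and the integral version of the problem. -/
theorem card_div_two_le_optValue {F : Set (G.edgeSet → ℝ)}
    (hF : F = fractionalMatchings G ∨ F = integralMatchings G) (M : G.Subgraph)
    (hM : M.IsPerfectMatching) : (Fintype.card V : ℝ) / 2 ≤ optValue G F := by
  classical
  let y : G.edgeSet → ℝ := fun e => if e.1 ∈ M.edgeSet then 1 else 0
  have hy : y ∈ integralMatchings G := ⟨M, hM.1, by
    funext e; simp only [y]⟩
  have hyF : y ∈ F := by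
    rcases hF with rfl | rfl
    · exact integralMatchings_subset hy
    · exact hy
  have hFsub : F ⊆ fractionalMatchings G := by
    rcases hF with rfl | rfl
    · exact le_rfl
    · exact integralMatchings_subset
  have hval : (Fintype.card V : ℝ) / 2 ≤ edgeValue G y := by
    have h := sum_sum_mem_edge y
    have h1 : ∀ v : V, 1 ≤ ∑ e : G.edgeSet with v ∈ e.1, y e := by
      intro v
      obtain ⟨w, hw, -⟩ := hM.1 (hM.2 v)
      have h2 : y ⟨s(v, w), hw.adj_sub⟩ = 1 := if_pos hw
      rw [← h2]
      refine Finset.single_le_sum (f := y) (fun e _ => ?_) (by simp)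
      simp only [y]; split_ifs <;> norm_num
    have h2 := Finset.sum_le_sum fun v (_ : v ∈ Finset.univ) => h1 v
    rw [h, Finset.sum_const, Finset.card_univ, nsmul_eq_mul, mul_one] at h2
    linarith
  refine hval.trans (le_csSup ⟨Fintype.card V / 2, ?_⟩ ⟨y, hyF, rfl⟩)
  rintro _ ⟨z, hz, rfl⟩
  exact edgeValue_le_of_mem_fractionalMatchings (hFsub hz)

end Matchings

/-! ### Expected outputs of local algorithms -/

section Expectation

variable {V ID R : Type} [Fintype V] [MeasurableSpace R] {G : SimpleGraph V} {k : ℕ}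
  {μ : Measure R} [IsProbabilityMeasure μ] {out : Sym2 (View ID R) → ℝ}

/-- The expected output of an algorithm for maximum matching is a fractional matching. -/
theorem IsLocalAlgorithm.expectation_mem {F : Set (G.edgeSet → ℝ)}
    (hF : F ⊆ fractionalMatchings G) (h : IsLocalAlgorithm G F k μ out) (id : V ↪ ID) :
    (fun e => ∫ ω, localOutput G k out id ω e ∂(Measure.pi fun _ : V => μ)) ∈
        fractionalMatchings G ∧
      ∫ ω, edgeValue G (localOutput G k out id ω) ∂(Measure.pi fun _ : V => μ) =
        edgeValue G fun e => ∫ ω, localOutput G k out id ω e ∂(Measure.pi fun _ : V => μ) := by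
  classical
  obtain ⟨hm, hae⟩ := h id
  have hae' : ∀ᵐ ω ∂(Measure.pi fun _ : V => μ),
      localOutput G k out id ω ∈ fractionalMatchings G := hae.mono fun ω hω => hF hω
  have hint : ∀ e, Integrable (fun ω => localOutput G k out id ω e)
      (Measure.pi fun _ : V => μ) := by
    intro e
    refine Integrable.of_bound (hm e).aestronglyMeasurable 1 (hae'.mono fun ω hω => ?_)
    rw [Real.norm_eq_abs, abs_of_nonneg (hω.1 e)]
    obtain ⟨v, hv⟩ : ∃ v, v ∈ e.1 := ⟨_, Sym2.out_fst_mem e.1⟩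
    exact (Finset.single_le_sum (f := localOutput G k out id ω) (fun e _ => hω.1 e)
      (by simpa using hv)).trans (hω.2 v)
  refine ⟨⟨fun e => integral_nonneg_of_ae (hae'.mono fun ω hω => hω.1 e), fun v => ?_⟩, ?_⟩
  · rw [← integral_finsetSum _ fun e _ => hint e]
    calc _ ≤ ∫ _, (1 : ℝ) ∂(Measure.pi fun _ : V => μ) :=
          integral_mono_ae (integrable_finsetSum _ fun e _ => hint e) (integrable_const _)
            (hae'.mono fun ω hω => hω.2 v)
      _ = 1 := by simp
  · simp only [edgeValue]
    exact integral_finsetSum _ fun e _ => hint e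

/-- If a permutation of the vertices carries the views of the ends of one edge to those of another
edge, then the expected value of the latter is that of the former under permuted identifiers: the
random values are exchangeable. -/
theorem integral_localOutput_comp_perm {u v u' v' : V} (huv : G.Adj u v) (huv' : G.Adj u' v')
    (φ : Equiv.Perm V) (id : V → ID)
    (hφ : ∀ ω : V → R, localView G k (id ∘ φ) (ω ∘ φ) u = localView G k id ω u' ∧
      localView G k (id ∘ φ) (ω ∘ φ) v = localView G k id ω v') :
    ∫ ω, localOutput G k out id ω ⟨s(u', v'), huv'⟩ ∂(Measure.pi fun _ : V => μ) =
      ∫ ω, localOutput G k out (id ∘ φ) ω ⟨s(u, v), huv⟩ ∂(Measure.pi fun _ : V => μ) := by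
  have hmp : MeasurePreserving (MeasurableEquiv.arrowCongr' φ.symm (MeasurableEquiv.refl R))
      (Measure.pi fun _ : V => μ) (Measure.pi fun _ : V => μ) :=
    measurePreserving_arrowCongr' (fun _ => μ) (fun _ => μ) φ.symm (MeasurableEquiv.refl R)
      fun _ => MeasurePreserving.id μ
  refine Eq.trans ?_ (hmp.integral_comp' fun ω =>
    localOutput G k out (id ∘ φ) ω ⟨s(u, v), huv⟩)
  refine integral_congr_ae (Filter.Eventually.of_forall fun ω => ?_)
  change out s(localView G k id ω u', localView G k id ω v') =
    out s(localView G k (id ∘ φ) (ω ∘ φ) u, localView G k (id ∘ φ) (ω ∘ φ) v)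
  rw [(hφ ω).1, (hφ ω).2]

/-- Averaging the expected output over all permutations of the identifiers yields a fractional
matching that has the approximation ratio of the algorithm and is constant on edges with the same
views. -/
theorem exists_symmetric_fractionalMatching {F : Set (G.edgeSet → ℝ)} {α : ℝ}
    (hF : F ⊆ fractionalMatchings G) (h : IsLocalAlgorithm G F k μ out)
    (hα : HasApproxRatio G F k μ out α) (id : V ↪ ID) :
    ∃ z ∈ fractionalMatchings G, optValue G F ≤ α * edgeValue G z ∧
      ∀ {u v u' v' : V} (huv : G.Adj u v) (huv' : G.Adj u' v') (φ : Equiv.Perm V),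
        (∀ (id : V → ID) (ω : V → R),
          localView G k (id ∘ φ) (ω ∘ φ) u = localView G k id ω u' ∧
          localView G k (id ∘ φ) (ω ∘ φ) v = localView G k id ω v') →
        z ⟨s(u, v), huv⟩ = z ⟨s(u', v'), huv'⟩ := by
  classical
  let x : Equiv.Perm V → G.edgeSet → ℝ := fun π e =>
    ∫ ω, localOutput G k out (id ∘ π) ω e ∂(Measure.pi fun _ : V => μ)
  have hx : ∀ π, x π ∈ fractionalMatchings G ∧ optValue G F ≤ α * edgeValue G (x π) := by
    intro π
    obtain ⟨h1, h2⟩ := h.expectation_mem hF (π.toEmbedding.trans id)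
    refine ⟨h1, ?_⟩
    have h3 := hα (π.toEmbedding.trans id)
    rw [h2] at h3
    exact h3
  let N : ℝ := Fintype.card (Equiv.Perm V)
  have hN : 0 < N := by simp only [N]; exact_mod_cast Fintype.card_pos
  have havg : ∀ c : ℝ, ∑ _π : Equiv.Perm V, c = N * c := by
    intro c; rw [Finset.sum_const, Finset.card_univ, nsmul_eq_mul]
  refine ⟨fun e => N⁻¹ * ∑ π, x π e, ⟨fun e => ?_, fun v => ?_⟩, ?_, ?_⟩
  · exact mul_nonneg (inv_nonneg.2 hN.le) (Finset.sum_nonneg fun π _ => (hx π).1.1 e)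
  · rw [← Finset.mul_sum, Finset.sum_comm, inv_mul_le_iff₀ hN, ← havg]
    exact Finset.sum_le_sum fun π _ => (hx π).1.2 v
  · have h1 := Finset.sum_le_sum fun π (_ : π ∈ Finset.univ) => (hx π).2
    rw [havg, ← Finset.mul_sum] at h1
    have h2 : edgeValue G (fun e => N⁻¹ * ∑ π, x π e) = N⁻¹ * ∑ π, edgeValue G (x π) := by
      simp only [edgeValue]
      rw [← Finset.mul_sum, Finset.sum_comm]
    rw [h2, mul_left_comm, ← div_eq_inv_mul, le_div_iff₀ hN, mul_comm]
    exact h1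
  · intro u v u' v' huv huv' φ hφ
    dsimp only
    congr 1
    refine (Fintype.sum_equiv (Equiv.mulRight φ) _ _ fun π => ?_).symm
    have := integral_localOutput_comp_perm (μ := μ) (out := out) huv huv' φ (id ∘ π)
      (hφ (id ∘ π))
    exact this

end Expectation

/-! ### The lower bound on cluster graphs -/

namespace IsClusterGraph

variable {V : Type} [Fintype V] {G : SimpleGraph V} {K δ : ℕ} {cl : V → List ℕ}

/-- The edges within the clusters form a perfect matching. -/
theorem exists_isPerfectMatching (hG : IsClusterGraph G K δ cl) :
    ∃ M : G.Subgraph, M.IsPerfectMatching := by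
  refine ⟨{ verts := Set.univ, Adj := fun v w => G.Adj v w ∧ cl v = cl w,
            adj_sub := fun h => h.1, edge_vert := fun _ => Set.mem_univ _,
            symm := ⟨fun v w h => ⟨h.1.symm, h.2.symm⟩⟩ }, fun v _ => ?_, fun v => Set.mem_univ v⟩
  have h := hG.ncard_eq v _ (hG.isCluster v)
  rw [clusterDeg_self, Set.ncard_eq_one] at h
  obtain ⟨w, hw⟩ := h
  have hw' : w ∈ {z | G.Adj v z ∧ cl z = cl v} := hw ▸ Set.mem_singleton w
  refine ⟨w, ⟨hw'.1, hw'.2.symm⟩, fun z hz => ?_⟩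
  have : z ∈ {z | G.Adj v z ∧ cl z = cl v} := ⟨hz.1, hz.2.symm⟩
  rw [hw] at this
  exact this

open Classical in
/-- The key estimate. The edges within the root cluster look like the edges between the root cluster
and its child of label `1`; as the vertices of this child have `δ` neighbours in the root cluster,
a symmetric fractional matching gives all these edges values at most `1 / δ`. -/
theorem edgeValue_le {k : ℕ} (hG : IsClusterGraph G (k + 2) δ cl) (hδ : 0 < δ)
    {z : G.edgeSet → ℝ} (hz : z ∈ fractionalMatchings G)
    (hsymm : ∀ {u v u' v' : V} (huv : G.Adj u v) (huv' : G.Adj u' v'),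
      branchType G (k + 1) u v = branchType G (k + 1) u' v' →
      branchType G (k + 1) v u = branchType G (k + 1) v' u' →
      z ⟨s(u, v), huv⟩ = z ⟨s(u', v'), huv'⟩) :
    edgeValue G z ≤ Finset.card {v | cl v ≠ []} + Finset.card {v | cl v = []} * (1 / δ : ℝ) := by
  have hδ' : (0 : ℝ) < δ := by exact_mod_cast hδ
  have h1c : IsCluster (k + 2) [1] :=
    ⟨trivial, by simp [stage], le_rfl, by omega, by simp [upLabel]⟩
  have hroot : ∀ {u v : V} (huv : G.Adj u v), cl u = [] → cl v = [] →
      z ⟨s(u, v), huv⟩ ≤ 1 / δ := by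
    intro u v huv hu hv
    obtain ⟨w, hw⟩ : {w | G.Adj u w ∧ cl w = [1]}.Nonempty := by
      rw [← Set.ncard_pos, hG.ncard_eq u _ h1c, hu, clusterDeg_child]
      exact pow_pos hδ _
    have hcard := hG.ncard_eq w [] trivial
    rw [hw.2, clusterDeg_tail, pow_one, Set.ncard_eq_toFinset_card'] at hcard
    have hsub : ∀ a : {a // a ∈ {a | G.Adj w a ∧ cl a = []}.toFinset}, G.Adj a.1 w := by
      rintro ⟨a, ha⟩
      have ha : G.Adj w a ∧ cl a = [] := by simpa using ha
      exact ha.1.symm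
    have hval : ∀ a : {a // a ∈ {a | G.Adj w a ∧ cl a = []}.toFinset},
        z ⟨s(a.1, w), hsub a⟩ = z ⟨s(u, v), huv⟩ := by
      intro a
      have ha : cl a.1 = [] := by
        obtain ⟨a, ha⟩ := a
        have ha : G.Adj w a ∧ cl a = [] := by simpa using ha
        exact ha.2
      refine hsymm _ _ ((hG.branchType_eq (k + 1) (hsub a) huv).2 ?_ ?_ ?_ ?_)
        ((hG.branchType_eq (k + 1) (hsub a).symm huv.symm).2 ?_ ?_ ?_ ?_) <;>
      simp [ha, hu, hv, hw.2, stage] <;> omega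
    have hle : ∑ a : {a // a ∈ {a | G.Adj w a ∧ cl a = []}.toFinset}, z ⟨s(a.1, w), hsub a⟩ ≤
        ∑ e : G.edgeSet with w ∈ e.1, z e := by
      let ed : {a // a ∈ {a | G.Adj w a ∧ cl a = []}.toFinset} → G.edgeSet := fun a =>
        ⟨s(a.1, w), hsub a⟩
      change ∑ a, z (ed a) ≤ _
      rw [← Finset.sum_image (f := z) (g := ed)]
      · refine Finset.sum_le_sum_of_subset_of_nonneg ?_ fun e _ _ => hz.1 e
        intro e he
        obtain ⟨a, -, rfl⟩ := Finset.mem_image.1 he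
        simp [ed]
      · intro a _ b _ hab
        have hab := congrArg Subtype.val hab
        simp only [ed, Sym2.congr_left] at hab
        exact Subtype.ext hab
    simp only [hval] at hle
    rw [Finset.sum_const, Finset.card_univ, Fintype.card_coe, hcard, nsmul_eq_mul] at hle
    rw [le_div_iff₀ hδ', mul_comm]
    exact hle.trans (hz.2 w)
  -- charge an edge to an end outside the root cluster, or to both ends if there is none
  let f : G.edgeSet → V → ℝ := fun e v =>
    if v ∈ e.1 then (if cl v ≠ [] ∨ ∀ u ∈ e.1, cl u = [] then z e else 0) else 0
  have hf0 : ∀ e v, 0 ≤ f e v := by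
    intro e v
    simp only [f]
    split_ifs <;> first | exact hz.1 e | exact le_rfl
  have hf1 : ∀ e, z e ≤ ∑ v, f e v := by
    intro e
    obtain ⟨v, hv, hv'⟩ : ∃ v ∈ e.1, cl v ≠ [] ∨ ∀ u ∈ e.1, cl u = [] := by
      by_cases h : ∀ u ∈ e.1, cl u = []
      · exact ⟨_, Sym2.out_fst_mem e.1, .inr h⟩
      · push Not at h
        obtain ⟨u, hu, hu'⟩ := h
        exact ⟨u, hu, .inl hu'⟩
    have : f e v = z e := by simp only [f]; rw [if_pos hv, if_pos hv']
    rw [← this]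
    exact Finset.single_le_sum (fun v _ => hf0 e v) (Finset.mem_univ v)
  have hf2 : ∀ v, ∑ e, f e v ≤ if cl v ≠ [] then 1 else 1 / (δ : ℝ) := by
    intro v
    have h1 : ∑ e, f e v = ∑ e : G.edgeSet with v ∈ e.1,
        if cl v ≠ [] ∨ ∀ u ∈ e.1, cl u = [] then z e else 0 := by
      rw [Finset.sum_filter]
    rw [h1]
    split_ifs with hv
    · refine le_trans (Finset.sum_le_sum fun e _ => ?_) (hz.2 v)
      split_ifs
      · exact le_rfl
      · exact hz.1 e
    · rw [not_not] at hv
      obtain ⟨w, hw⟩ := Set.ncard_eq_one.1 ((hG.ncard_eq v [] trivial).trans (by rw [hv]; simp))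
      have hw' : w ∈ {z | G.Adj v z ∧ cl z = []} := hw ▸ Set.mem_singleton w
      refine le_trans (le_of_eq (Finset.sum_eq_single (⟨s(v, w), hw'.1⟩ : G.edgeSet) ?_ ?_)) ?_
      · rintro e he hne
        rw [if_neg]
        rintro (h | h)
        · exact h hv
        · obtain ⟨x, hx⟩ := Sym2.mem_iff_exists.1 (Finset.mem_filter.1 he).2
          apply hne
          apply Subtype.ext
          have hadj : G.Adj v x := by
            have := e.2
            rw [hx] at this
            exact this
          have : x ∈ {z | G.Adj v z ∧ cl z = []} := ⟨hadj, h x (by rw [hx]; simp)⟩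
          rw [hw] at this
          rw [hx, Set.mem_singleton_iff.1 this]
      · intro h; simp at h
      · split_ifs
        · exact hroot hw'.1 hv hw'.2
        · positivity
  calc edgeValue G z ≤ ∑ e, ∑ v, f e v := Finset.sum_le_sum fun e _ => hf1 e
    _ = ∑ v, ∑ e, f e v := Finset.sum_comm
    _ ≤ ∑ v, if cl v ≠ [] then 1 else 1 / (δ : ℝ) := Finset.sum_le_sum fun v _ => hf2 v
    _ = _ := by
      rw [Finset.sum_ite]
      simp

theorem optValue_bound {k : ℕ} (hG : IsClusterGraph G (k + 2) δ cl) (hδ : 0 < δ)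
    (hg : ((2 * (k + 1) + 1 : ℕ) : ℕ∞) < G.egirth) {F : Set (G.edgeSet → ℝ)}
    (hF : F = fractionalMatchings G ∨ F = integralMatchings G) {ID R : Type} [MeasurableSpace R]
    {μ : Measure R} [IsProbabilityMeasure μ] {out : Sym2 (View ID R) → ℝ}
    (hID : Nonempty (V ↪ ID)) (halg : IsLocalAlgorithm G F (k + 1) μ out) {α : ℝ}
    (hα : HasApproxRatio G F (k + 1) μ out α) [Nonempty V] :
    (Fintype.card V : ℝ) / 2 ≤
      α * ({v | cl v ≠ []}.ncard + {v | cl v = []}.ncard * (1 / δ : ℝ)) := by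
  classical
  have hFsub : F ⊆ fractionalMatchings G := by
    rcases hF with rfl | rfl
    · exact le_rfl
    · exact integralMatchings_subset
  obtain ⟨id⟩ := hID
  obtain ⟨z, hz, hzα, hsymm⟩ := exists_symmetric_fractionalMatching hFsub halg hα id
  have h1 := hG.edgeValue_le hδ hz fun huv huv' h1 h2 => by
    obtain ⟨φ, hφ⟩ := exists_perm_localView huv huv' hg h1 h2
    exact hsymm huv huv' φ (hφ ID R)
  obtain ⟨M, hM⟩ := hG.exists_isPerfectMatching
  have h2 := (card_div_two_le_optValue hF M hM).trans hzα
  have h3 : 0 ≤ edgeValue G z := Finset.sum_nonneg fun e _ => hz.1 e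
  have hV : (0 : ℝ) < Fintype.card V := by exact_mod_cast Fintype.card_pos
  -- the ratio is positive as the optimum is
  have hα0 : 0 ≤ α := by
    by_contra! hneg
    have := mul_nonpos_of_nonpos_of_nonneg hneg.le h3
    linarith
  refine h2.trans (mul_le_mul_of_nonneg_left ?_ hα0)
  rw [Set.ncard_eq_toFinset_card', Set.ncard_eq_toFinset_card']
  simpa using h1

end IsClusterGraph

/-! ### Sizes of the clusters -/

theorem arcLabel_le {K : ℕ} {x y : List ℕ} (hx : IsCluster K x) (hy : IsCluster K y) :
    arcLabel x y ≤ K + 1 := by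
  have h1 := (upLabel_le x).trans (Nat.succ_le_succ hx.stage_le)
  have h2 := (upLabel_le y).trans (Nat.succ_le_succ hy.stage_le)
  unfold arcLabel
  split_ifs <;> omega

theorem clusterDeg_le {K δ : ℕ} (hδ : 0 < δ) {x y : List ℕ} (hx : IsCluster K x)
    (hy : IsCluster K y) : clusterDeg δ x y ≤ δ ^ K := by
  unfold clusterDeg
  split_ifs
  · exact Nat.pow_le_pow_right hδ (by have := arcLabel_le hx hy; omega)
  · exact Nat.zero_le _

theorem clusterDeg_balance {K : ℕ} (W δ : ℕ) {x y : List ℕ} (hx : IsCluster K x)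
    (hy : IsCluster K y) :
    W * δ ^ (K - x.length) * clusterDeg δ x y = W * δ ^ (K - y.length) * clusterDeg δ y x := by
  have key : ∀ {l : ℕ} {t : List ℕ}, IsCluster K (l :: t) →
      W * δ ^ (K - (l :: t).length) * clusterDeg δ (l :: t) t =
        W * δ ^ (K - t.length) * clusterDeg δ t (l :: t) := by
    intro l t h
    have h1 := (length_le_stage _).trans h.stage_le
    have h2 := h.2.2.1
    rw [List.length_cons] at h1
    rw [clusterDeg_tail, clusterDeg_child, List.length_cons, mul_assoc, mul_assoc, ← pow_add,
      ← pow_add]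
    congr 2
    omega
  have hsymm : clusterDeg δ x y ≠ 0 ∨ clusterDeg δ y x ≠ 0 →
      x = y ∨ (∃ l, x = l :: y) ∨ ∃ l, y = l :: x := by
    rintro (h | h)
    · exact clusterDeg_ne_zero h
    · rcases clusterDeg_ne_zero h with h | h | h
      · exact .inl h.symm
      · exact .inr (.inr h)
      · exact .inr (.inl h)
  by_cases h : clusterDeg δ x y ≠ 0 ∨ clusterDeg δ y x ≠ 0
  · rcases hsymm h with rfl | ⟨l, rfl⟩ | ⟨l, rfl⟩
    · rfl
    · exact key hx
    · exact (key hy).symm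
  · push Not at h
    rw [h.1, h.2]; simp

/-- There are cluster graphs of large girth in which the root cluster dominates all others by a
factor `δ`, and whose size is polynomial in `δ` with the right exponent. -/
theorem exists_clusterGraph (k : ℕ) : ∃ A : ℕ, 1 ≤ A ∧ ∀ δ : ℕ, 1 ≤ δ →
    ∃ (n : ℕ) (G : SimpleGraph (Fin n)) (cl : Fin n → List ℕ) (w₀ : ℕ),
      IsClusterGraph G (k + 2) δ cl ∧ ((2 * (k + 1) + 1 : ℕ) : ℕ∞) < G.egirth ∧
      0 < w₀ ∧ δ * w₀ ≤ n ∧ n ≤ A * δ ^ (4 * (k + 1) ^ 2) ∧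
      {v | cl v = []}.ncard ≤ A * (δ * w₀) ∧ {v | cl v = []}.Nonempty ∧
      {v | cl v ≠ []}.ncard ≤ A * w₀ ∧
      ∀ v, {z | G.Adj v z}.ncard ≤ A * δ ^ (k + 2) := by
  classical
  let K := k + 2
  let X := {x : List ℕ // IsCluster K x}
  have : Fintype X := Fintype.ofFinite X
  let root : X := ⟨[], trivial⟩
  let C := Fintype.card X
  have hC : 1 ≤ C := Fintype.card_pos_iff.2 ⟨root⟩
  refine ⟨6 * C * (2 * C) ^ (2 * k + 1), Nat.one_le_iff_ne_zero.2 (by positivity), fun δ hδ => ?_⟩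
  set A := 6 * C * (2 * C) ^ (2 * k + 1) with hA
  have hCA : 6 * C ≤ A := Nat.le_mul_of_pos_right _ (by positivity)
  let Δ := C * δ ^ K
  let W := 2 * (Δ + 1) ^ (2 * k + 1) + 1
  let w : X → ℕ := fun x => W * δ ^ (K - x.1.length)
  have hWw : ∀ x, W ≤ w x := fun x => Nat.le_mul_of_pos_right _ (pow_pos hδ _)
  obtain ⟨n, G, cl, hn, hcl, hnb, hg⟩ := exists_graph_of_degrees w
    (fun x y => clusterDeg δ x.1 y.1) Δ k (fun x y => clusterDeg_balance W δ x.2 y.2)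
    (fun x => by
      refine (Finset.sum_le_card_nsmul _ _ (δ ^ K) fun y _ => clusterDeg_le hδ x.2 y.2).trans ?_
      rw [Finset.card_univ, smul_eq_mul])
    (fun x => lt_of_lt_of_le (Nat.lt_succ_self _) (hWw x))
  have hroot : w root = δ * (W * δ ^ (k + 1)) := by
    simp only [w, root, List.length_nil, Nat.sub_zero, K]
    ring
  have hpos : 0 < W * δ ^ (k + 1) := Nat.mul_pos (Nat.succ_pos _) (pow_pos hδ _)
  have hncard : ∀ x : X, {v | (cl v).1 = x.1}.ncard = 2 * w x := by
    intro x
    rw [← hcl x]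
    congr 1
    ext v
    exact Subtype.ext_iff.symm
  refine ⟨n, G, fun v => (cl v).1, W * δ ^ (k + 1), ⟨fun v => (cl v).2, fun v y hy => ?_⟩, hg, hpos,
    ?_, ?_, ?_, ?_, ?_, ?_⟩
  · rw [← hnb v ⟨y, hy⟩]
    congr 1
    ext z
    exact and_congr_right fun _ => ⟨fun h => Subtype.ext h, fun h => congrArg Subtype.val h⟩
  · rw [hn, ← hroot]
    have := Finset.single_le_sum (f := w) (fun _ _ => Nat.zero_le _) (Finset.mem_univ root)
    omega
  · have h1 : ∑ x, w x ≤ C * (W * δ ^ K) := by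
      refine (Finset.sum_le_card_nsmul _ _ (W * δ ^ K) fun x _ => ?_).trans ?_
      · exact Nat.mul_le_mul_left _ (Nat.pow_le_pow_right hδ (Nat.sub_le _ _))
      · rw [Finset.card_univ, smul_eq_mul]
    have hδK : 1 ≤ C * δ ^ K := Nat.mul_pos hC (pow_pos hδ _)
    have h2 : W ≤ 3 * (2 * C * δ ^ K) ^ (2 * k + 1) := by
      have h3 : (Δ + 1) ^ (2 * k + 1) ≤ (2 * C * δ ^ K) ^ (2 * k + 1) :=
        Nat.pow_le_pow_left (by simp only [Δ]; nlinarith) _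
      have h4 : 1 ≤ (2 * C * δ ^ K) ^ (2 * k + 1) :=
        Nat.one_le_pow _ _ (by nlinarith)
      simp only [W]
      omega
    calc n ≤ 2 * (C * (3 * (2 * C * δ ^ K) ^ (2 * k + 1) * δ ^ K)) := by
          rw [hn]
          exact Nat.mul_le_mul_left _ (h1.trans
            (Nat.mul_le_mul_left _ (Nat.mul_le_mul_right _ h2)))
      _ = A * δ ^ (K * (2 * k + 2)) := by
          rw [hA, mul_pow, ← pow_mul, show K * (2 * k + 2) = K * (2 * k + 1) + K by ring, pow_add]
          ring
      _ ≤ A * δ ^ (4 * (k + 1) ^ 2) :=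
          Nat.mul_le_mul_left _ (Nat.pow_le_pow_right hδ (by simp only [K]; nlinarith))
  · have h1 := hncard root
    simp only [root] at h1
    rw [h1, hroot]
    exact Nat.mul_le_mul_right _ (by omega)
  · rw [← Set.ncard_pos]
    have h1 := hncard root
    simp only [root] at h1
    rw [h1, hroot]
    have := Nat.mul_pos hδ hpos
    omega
  · have hsub : {v | (cl v).1 ≠ []} ⊆
        ↑(((Finset.univ : Finset X).erase root).biUnion fun x => {v | cl v = x}) := by
      intro v hv
      simp only [Finset.coe_biUnion, Set.mem_iUnion, Finset.mem_coe, Finset.mem_erase,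
        Finset.mem_univ, Finset.mem_filter, true_and, and_true, exists_prop]
      exact ⟨cl v, fun h => hv (congrArg Subtype.val h), rfl⟩
    refine (Set.ncard_le_ncard hsub (Finset.finite_toSet _)).trans ?_
    rw [Set.ncard_coe_finset]
    refine (Finset.card_biUnion_le_card_mul _ _ (2 * (W * δ ^ (k + 1))) fun x hx => ?_).trans ?_
    · rw [← Set.ncard_coe_finset, Finset.coe_filter_univ, hcl x]
      refine Nat.mul_le_mul_left _ (Nat.mul_le_mul_left _ (Nat.pow_le_pow_right hδ ?_))
      have : x.1.length ≠ 0 := fun h =>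
        (Finset.mem_erase.1 hx).1 (Subtype.ext (List.length_eq_zero_iff.1 h))
      simp only [K]
      omega
    · rw [← mul_assoc]
      refine Nat.mul_le_mul_right _ ?_
      have : ((Finset.univ : Finset X).erase root).card ≤ C := Finset.card_le_univ _
      omega
  · intro v
    have hsub : {z | G.Adj v z} ⊆
        ↑((Finset.univ : Finset X).biUnion fun y => {z | G.Adj v z ∧ cl z = y}) := by
      intro z hz
      simpa using hz
    refine (Set.ncard_le_ncard hsub (Finset.finite_toSet _)).trans ?_
    rw [Set.ncard_coe_finset]
    refine (Finset.card_biUnion_le_card_mul _ _ (δ ^ K) fun y _ => ?_).trans ?_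
    · rw [← Set.ncard_coe_finset, Finset.coe_filter_univ, hnb v y]
      exact clusterDeg_le hδ (cl v).2 y.2
    · rw [Finset.card_univ]
      exact Nat.mul_le_mul_right _ (by omega)

/-! ### Asymptotics -/

/-- A quantity of order at most `δ ^ m` has `((1 - η) / m)`-th power below any fixed fraction of
`δ`, for large `δ`. -/
theorem eventually_rpow_le (A C η : ℝ) (hA : 1 ≤ A) (hC : 0 < C) (hη : 0 < η) (m : ℕ)
    (hm : 0 < m) : ∀ᶠ δ : ℕ in Filter.atTop, ∀ x : ℝ, 1 ≤ x → x ≤ A * (δ : ℝ) ^ m →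
      x ^ ((1 - η) / m) ≤ δ / C := by
  have hm' : (0 : ℝ) < m := by exact_mod_cast hm
  by_cases h1 : 1 ≤ η
  · filter_upwards [tendsto_natCast_atTop_atTop.eventually_ge_atTop C] with δ hδ x hx _
    refine (Real.rpow_le_one_of_one_le_of_nonpos hx
      (div_nonpos_of_nonpos_of_nonneg (by linarith) hm'.le)).trans ?_
    rwa [one_le_div hC]
  · push Not at h1
    have hs : 0 ≤ (1 - η) / m := div_nonneg (by linarith) hm'.le
    have ht : Filter.Tendsto (fun δ : ℕ => (δ : ℝ) ^ η) Filter.atTop Filter.atTop :=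
      (tendsto_rpow_atTop hη).comp tendsto_natCast_atTop_atTop
    filter_upwards [ht.eventually_ge_atTop (A ^ ((1 - η) / m) * C),
      Filter.eventually_gt_atTop 0] with δ hδ hδ0 x hx hxA
    have hδ' : (0 : ℝ) < δ := by exact_mod_cast hδ0
    refine (Real.rpow_le_rpow (by linarith) hxA hs).trans ?_
    rw [Real.mul_rpow (by linarith) (by positivity), ← Real.rpow_natCast, ← Real.rpow_mul hδ'.le,
      mul_div_cancel₀ _ hm'.ne', le_div_iff₀ hC]
    calc A ^ ((1 - η) / m) * (δ : ℝ) ^ (1 - η) * C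
        = A ^ ((1 - η) / m) * C * (δ : ℝ) ^ (1 - η) := by ring
      _ ≤ (δ : ℝ) ^ η * (δ : ℝ) ^ (1 - η) :=
        mul_le_mul_of_nonneg_right hδ (Real.rpow_nonneg hδ'.le _)
      _ = δ := by rw [← Real.rpow_add hδ']; simp

theorem mainTheorem2 (ε : ℝ) (hε : 0 < ε) :
    ∃ c : ℝ, 0 < c ∧ ∀ k : ℕ, 1 ≤ k → ∀ N : ℕ,
      ∃ (n : ℕ) (G : SimpleGraph (Fin n)) (_ : DecidableRel G.Adj),
        N ≤ n ∧ N ≤ G.maxDegree ∧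
        ∀ F : Set (G.edgeSet → ℝ), (F = fractionalMatchings G ∨ F = integralMatchings G) →
          ∀ (ID : Type) (R : Type) [MeasurableSpace R] (μ : MeasureTheory.Measure R)
            [MeasureTheory.IsProbabilityMeasure μ] (out : Sym2 (View ID R) → ℝ),
            Nonempty (Fin n ↪ ID) →
            IsLocalAlgorithm G F k μ out →
            ∀ α : ℝ, HasApproxRatio G F k μ out α →
              c * (n : ℝ) ^ ((1 / 4 - ε) / (k : ℝ) ^ 2) ≤ α ∧
              c * (G.maxDegree : ℝ) ^ ((1 - ε) / ((k : ℝ) + 1)) ≤ α := by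
  classical
  refine ⟨1, one_pos, fun k hk N => ?_⟩
  obtain ⟨k, rfl⟩ : ∃ j, k = j + 1 := ⟨k - 1, by omega⟩
  obtain ⟨A, hA1, hA⟩ := exists_clusterGraph k
  have hA1' : (1 : ℝ) ≤ A := by exact_mod_cast hA1
  -- the degree parameter `δ`
  obtain ⟨δ, hδn, hδd, hδN⟩ := ((eventually_rpow_le A (4 * A) (4 * ε) hA1' (by linarith)
    (by linarith) (4 * (k + 1) ^ 2) (by positivity)).and
    ((eventually_rpow_le A (4 * A) ε hA1' (by linarith) hε (k + 2) (by omega)).and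
    (Filter.eventually_ge_atTop (N + 1)))).exists
  obtain ⟨n, G, cl, w₀, hG, hg, hw₀, hn0, hn1, hr, ⟨v₀, hv₀⟩, hnr, hdeg⟩ := hA δ (by omega)
  have hδ' : (0 : ℝ) < δ := by exact_mod_cast (by omega : 0 < δ)
  have hδn0 : δ ≤ n := (Nat.le_mul_of_pos_right _ hw₀).trans hn0
  have hdeg' : ∀ v, G.degree v ≤ A * δ ^ (k + 2) := by
    intro v
    refine le_trans (le_of_eq ?_) (hdeg v)
    rw [Set.ncard_eq_toFinset_card', ← SimpleGraph.card_neighborFinset_eq_degree]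
    congr 1
  have hmax : δ ≤ G.maxDegree := by
    refine le_trans ?_ (G.degree_le_maxDegree v₀)
    have h1 := hG.ncard_eq v₀ [k + 2]
      ⟨trivial, by simp [stage], by omega, le_rfl, by simp [upLabel]⟩
    have hv₀ : cl v₀ = [] := hv₀
    rw [hv₀, clusterDeg_child] at h1
    calc δ ≤ δ ^ (k + 2 - 1) := Nat.le_self_pow (by omega) δ
      _ = _ := h1.symm
      _ ≤ G.degree v₀ := by
        rw [Set.ncard_eq_toFinset_card', ← SimpleGraph.card_neighborFinset_eq_degree]
        refine Finset.card_le_card fun z hz => ?_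
        have hz : G.Adj v₀ z ∧ cl z = [k + 2] := by simpa using hz
        simpa using hz.1
  refine ⟨n, G, inferInstance, by omega, by omega, ?_⟩
  intro F hF ID R _ μ _ out hID halg α hα
  have : Nonempty (Fin n) := ⟨v₀⟩
  have hbound := hG.optValue_bound (by omega) hg hF hID halg hα
  rw [Fintype.card_fin] at hbound
  have hw₀' : (0 : ℝ) < w₀ := by exact_mod_cast hw₀
  have hn0' : (δ : ℝ) * w₀ ≤ n := by exact_mod_cast hn0
  have hr' : ({v | cl v = []}.ncard : ℝ) ≤ A * (δ * w₀) := by exact_mod_cast hr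
  have hnr' : ({v | cl v ≠ []}.ncard : ℝ) ≤ A * w₀ := by exact_mod_cast hnr
  have hB : ({v | cl v ≠ []}.ncard : ℝ) + {v | cl v = []}.ncard * (1 / δ : ℝ) ≤ 2 * A * w₀ := by
    have h1 := mul_le_mul_of_nonneg_right hr' (by positivity : (0 : ℝ) ≤ 1 / δ)
    have h2 : (A : ℝ) * (δ * w₀) * (1 / δ) = A * w₀ := by field_simp
    linarith
  have hα0 : 0 ≤ α := by
    by_contra! hneg
    have h1 : α * (({v | cl v ≠ []}.ncard : ℝ) + {v | cl v = []}.ncard * (1 / δ : ℝ)) ≤ 0 :=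
      mul_nonpos_of_nonpos_of_nonneg hneg.le (by positivity)
    have h2 : 0 < (δ : ℝ) * w₀ := by positivity
    linarith
  have hαδ : (δ : ℝ) / (4 * A) ≤ α := by
    have h1 := hbound.trans (mul_le_mul_of_nonneg_left hB hα0)
    rw [div_le_iff₀ (by linarith)]
    have h2 : (δ : ℝ) * w₀ ≤ α * (4 * A) * w₀ := by linarith
    exact le_of_mul_le_mul_right h2 hw₀'
  rw [one_mul, one_mul]
  constructor
  · refine le_trans ?_ hαδ
    have h1 := hδn n (by exact_mod_cast (by omega : 1 ≤ n)) (by exact_mod_cast hn1)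
    rw [show (1 / 4 - ε) / ((k + 1 : ℕ) : ℝ) ^ 2 =
      (1 - 4 * ε) / ((4 * (k + 1) ^ 2 : ℕ) : ℝ) by push_cast; field_simp]
    exact h1
  · refine le_trans ?_ hαδ
    have h1 := hδd G.maxDegree (by exact_mod_cast (by omega : 1 ≤ G.maxDegree))
      (by exact_mod_cast G.maxDegree_le_of_forall_degree_le _ hdeg')
    rw [show ((k + 1 : ℕ) : ℝ) + 1 = ((k + 2 : ℕ) : ℝ) by push_cast; ring]
    exact h1
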